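/- Let $\mathcal H$ be a complex separable Hilbert space with a complex conjugation $\mathcal C$ (an anti-unitary operator with $\mathcal C^2=\mathbf 1$), and let $I$ be a unitary on $\mathcal H$ which is real ($\mathcal C I\mathcal C=I$) and satisfies $I^2=-\mathbf 1$. For a bounded operator $T$ let $T^t=(\mathcal C T\mathcal C)^*$ be its transpose, and call $T$ odd symmetric if $I^*T^tI=T$. Let $\widehat{\mathbb{SF}}_*(\mathcal H)$ be the set of self-adjoint Fredholm operators $F$ with $\|F\|=1$ and $\sigma_{\rm ess}(F)=\{-1,1\}$. Let $\mathbb P(\mathcal H,I)$ be the set of pairs $(F,U)$ where $F\in\widehat{\mathbb{SF}}_*(\mathcal H)$ is odd symmetric, $U$ is an odd symmetric unitary and $[F,U]$ is compact; it carries the subspace topology of the norm topology. For a norm continuous path $s\in[\alpha,\beta]\mapsto F_s$ of self-adjoint Fredholm operators with essential spectrum $\{-1,1\}$, choose a partition $\alpha=s_0<\dots<s_N=\beta$ and numbers $-1<a_n<0<b_n<1$ such that $s\in[s_{n-1},s_n]\mapsto\chi_{(a_n,b_n]}(F_s)$ is norm continuous with constant finite rank, and set $$\mathrm{SF}(s\in[\alpha,\beta]\mapsto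 F_s)=\sum_{n=1}^N \mathrm{Tr}\bigl(\chi_{(a_n,0]}(F_{s_{n-1}})-\chi_{(a_n,0]}(F_{s_n})\bigr)\in\mathbb Z .$$ For $(F,U)\in\mathbb P(\mathcal H,I)$ let $$\mathrm{SF}_2(F,U)=\mathrm{SF}\bigl(s\in[0,\tfrac12]\mapsto F+s\,U^*[F,U]\bigr)\bmod 2\in\mathbb Z_2 .$$ Then the $\mathbb Z_2$ spectral flow $\mathrm{SF}_2:\mathbb P(\mathcal H,I)\to\mathbb Z_2$ is well defined and locally constant; in particular it is constant along every continuous path in $\mathbb P(\mathcal H,I)$. Here well-definedness means the following. For each $(F,U)\in\mathbb P(\mathcal H,I)$ let $\Theta(F,U,I)$ be the set of norm continuous paths $s\in[0,1]\mapsto F_s\in\widehat{\mathbb{SF}}_*(\mathcal H)$ with $F_0=F$, $F_s-F$ compact and $F_{1-s}=(IU)^*(F_s)^t(IU)$ for all $s$. The path $s\mapsto F+s\,U^*[F,U]$ lies in $\Theta(F,U,I)$. For every path in $\Theta(F,U,I)$, a partition as above of $[0,\tfrac12]$ exists, the resulting integer $\mathrm{SF}(s\in[0,\frac12]\mapsto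 F_s)$ does not depend on the choices, and its class modulo $2$ equals $\mathrm{SF}_2(F,U)$. -/

import Mathlib

noncomputable section

namespace ZTwoFlow

variable {H : Type*} [NormedAddCommGroup H] [InnerProductSpace ℂ H] [CompleteSpace H]

/-- The essential spectrum: all `z` such that `T - z` is not a Fredholm operator. -/
def essSpectrum (T : H →L[ℂ] H) : Set ℂ :=
  {z | ¬ (T - z • (1 : H →L[ℂ] H)).IsFredholm}

/-- Self-adjoint Fredholm operators. -/
def SF (H : Type*) [NormedAddCommGroup H] [InnerProductSpace ℂ H] [CompleteSpace H] :
    Set (H →L[ℂ] H) :=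
  {F | F.IsFredholm ∧ IsSelfAdjoint F}

/-- Self-adjoint Fredholm operators with positive as well as negative essential spectrum. -/
def SFstar (H : Type*) [NormedAddCommGroup H] [InnerProductSpace ℂ H] [CompleteSpace H] :
    Set (H →L[ℂ] H) :=
  {F | F ∈ SF H ∧ (∃ x : ℝ, 0 < x ∧ (x : ℂ) ∈ essSpectrum F) ∧
    (∃ x : ℝ, x < 0 ∧ (x : ℂ) ∈ essSpectrum F)}

/-- Those operators in `SFstar H` with norm `1` and essential spectrum `{-1, 1}`. -/
def SFhat (H : Type*) [NormedAddCommGroup H] [InnerProductSpace ℂ H] [CompleteSpace H] :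
    Set (H →L[ℂ] H) :=
  {F | F ∈ SFstar H ∧ ‖F‖ = 1 ∧ essSpectrum F = {-1, 1}}

/-- The spectral projection `χ_{(-∞, c]}(T)` of a self-adjoint operator `T`: the orthogonal
projection onto the kernel of the positive part `(T - c)₊` (which is the range of
`χ_{(-∞, c]}(T)`). The positive part is formed with the continuous functional calculus. -/
def specProjIic (T : H →L[ℂ] H) (c : ℝ) : H →L[ℂ] H :=
  (cfc (fun x : ℝ => max (x - c) 0) T).ker.starProjection

/-- The spectral projection `χ_{(a, b]}(T)` of a self-adjoint operator `T`, for `a ≤ b`. -/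
def specProj (T : H →L[ℂ] H) (a b : ℝ) : H →L[ℂ] H :=
  specProjIic T b - specProjIic T a

/-- The dimension of the range of `χ_{(a, b]}(T)`, which is the trace of this projection whenever
its range is finite-dimensional. -/
def specRank (T : H →L[ℂ] H) (a b : ℝ) : ℕ :=
  Module.finrank ℂ (specProj T a b).range

/-- Data for computing the spectral flow of the path `s ↦ F s`, `s ∈ [α, β]`: a partition
`α = s₀ < s₁ < ⋯ < s_N = β` and numbers `aₙ < 0 < bₙ` such that `s ↦ χ_{(aₙ, bₙ]}(F s)` is norm
continuous with constant finite rank on the `n`-th interval of the partition. -/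
structure FlowPartition (F : ℝ → H →L[ℂ] H) (α β : ℝ) where
  N : ℕ
  s : Fin (N + 1) → ℝ
  a : Fin N → ℝ
  b : Fin N → ℝ
  s_mono : StrictMono s
  s_first : s 0 = α
  s_last : s (Fin.last N) = β
  a_mem : ∀ n, a n ∈ Set.Ioo (-1 : ℝ) 0
  b_mem : ∀ n, b n ∈ Set.Ioo (0 : ℝ) 1
  continuousOn : ∀ n, ContinuousOn (fun t => specProj (F t) (a n) (b n))
    (Set.Icc (s n.castSucc) (s n.succ))
  finite_rank : ∀ n, ∀ t ∈ Set.Icc (s n.castSucc) (s n.succ),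
    FiniteDimensional ℂ (specProj (F t) (a n) (b n)).range
  const_rank : ∀ n, ∃ k, ∀ t ∈ Set.Icc (s n.castSucc) (s n.succ),
    specRank (F t) (a n) (b n) = k

/-- The sum `∑ₙ Tr (χ_{(aₙ, 0]}(F sₙ₋₁) - χ_{(aₙ, 0]}(F sₙ))` attached to a partition. -/
def FlowPartition.value {F : ℝ → H →L[ℂ] H} {α β : ℝ} (P : FlowPartition F α β) : ℤ :=
  ∑ n : Fin P.N, ((specRank (F (P.s n.castSucc)) (P.a n) 0 : ℤ) -
    (specRank (F (P.s n.succ)) (P.a n) 0 : ℤ))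

/-- `k` is the spectral flow of `s ∈ [α, β] ↦ F s` computed through some partition. -/
def HasSpectralFlow (F : ℝ → H →L[ℂ] H) (α β : ℝ) (k : ℤ) : Prop :=
  ∃ P : FlowPartition F α β, P.value = k

open Classical in
/-- The spectral flow of `s ∈ [α, β] ↦ F s` (with value `0` if there is no partition). -/
def spectralFlow (F : ℝ → H →L[ℂ] H) (α β : ℝ) : ℤ :=
  if h : ∃ k, HasSpectralFlow F α β k then h.choose else 0

/-- The complex conjugate `C T C` of `T` for a complex conjugation `C`. -/
def conjOp (C : H ≃ₗᵢ⋆[ℂ] H) (T : H →L[ℂ] H) : H →L[ℂ] H :=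
  (C.toContinuousLinearEquiv : H →L⋆[ℂ] H).comp
    (T.comp (C.toContinuousLinearEquiv : H →L⋆[ℂ] H))

/-- The transpose `(C T C)*` of `T`. -/
def transposeOp (C : H ≃ₗᵢ⋆[ℂ] H) (T : H →L[ℂ] H) : H →L[ℂ] H :=
  star (conjOp C T)

/-- `C` is an anti-unitary involution and `I` is a real unitary with `I² = -1`. -/
structure IsQuaternionicData (C : H ≃ₗᵢ⋆[ℂ] H) (I : H →L[ℂ] H) : Prop where
  conj_conj : ∀ x, C (C x) = x
  mem_unitary : I ∈ unitary (H →L[ℂ] H)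
  real : conjOp C I = I
  sq : I * I = -1

/-- `T` is odd symmetric: `I* Tᵗ I = T`. -/
def IsOddSymmetric (C : H ≃ₗᵢ⋆[ℂ] H) (I T : H →L[ℂ] H) : Prop :=
  star I * transposeOp C T * I = T

/-- The set of pairs `(F, U)` with `F ∈ SFhat H` odd symmetric, `U` an odd symmetric unitary and
`[F, U]` compact. As a type it carries the subspace topology of the norm topology. -/
def PairSpace (C : H ≃ₗᵢ⋆[ℂ] H) (I : H →L[ℂ] H) : Set ((H →L[ℂ] H) × (H →L[ℂ] H)) :=
  {p | p.1 ∈ SFhat H ∧ IsOddSymmetric C I p.1 ∧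
    p.2 ∈ unitary (H →L[ℂ] H) ∧ IsOddSymmetric C I p.2 ∧
    IsCompactOperator (p.1 * p.2 - p.2 * p.1)}

/-- The set `Θ(F, U, I)` of norm continuous paths `γ : [0, 1] → SFhat H` with `γ 0 = F`,
`γ s - F` compact and `γ (1 - s) = (I U)* (γ s)ᵗ (I U)`. Values outside `[0, 1]` are irrelevant. -/
def SymmetricPaths (C : H ≃ₗᵢ⋆[ℂ] H) (I F U : H →L[ℂ] H) : Set (ℝ → H →L[ℂ] H) :=
  {γ | ContinuousOn γ (Set.Icc 0 1) ∧ (∀ s ∈ Set.Icc (0 : ℝ) 1, γ s ∈ SFhat H) ∧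
    γ 0 = F ∧
    (∀ s ∈ Set.Icc (0 : ℝ) 1, IsCompactOperator (γ s - F)) ∧
    (∀ s ∈ Set.Icc (0 : ℝ) 1,
      γ (1 - s) = star (I * U) * transposeOp C (γ s) * (I * U))}

/-- The path `s ↦ F + s U* [F, U]`. -/
def linePath (F U : H →L[ℂ] H) (s : ℝ) : H →L[ℂ] H :=
  F + (s : ℂ) • (star U * (F * U - U * F))

/-- The `ℤ/2`-valued spectral flow `SF₂(F, U)`: the spectral flow of
`s ∈ [0, 1/2] ↦ F + s U* [F, U]` modulo `2`. -/
def SF2 (C : H ≃ₗᵢ⋆[ℂ] H) (I : H →L[ℂ] H) (p : PairSpace C I) : ZMod 2 :=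
  (spectralFlow (linePath p.1.1 p.1.2) 0 (1 / 2) : ZMod 2)

end ZTwoFlow

end

noncomputable section

open Set Filter Topology

namespace ZTwoFlow

variable {H : Type*} [NormedAddCommGroup H] [InnerProductSpace ℂ H] [CompleteSpace H]

/-! ### Spectral projections -/

/-! The parity survives because of Kramers degeneracy at both ends of the half path. Odd symmetry of
`F` says that `F` commutes with the anti-unitary `C I`, whose square is `-1`. The symmetry under `s
↦ 1 - s` has `1/2` as its fixed point, so the operator at `1/2` commutes with the anti-unitary `C I
U`, whose square is again `-1` because `U` is odd symmetric. Such an anti-unitary acts as a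
quaternionic structure on each spectral subspace, so spectral ranks at both ends are even
(`IsKramers.even_specRank`).

The analytic half is a stability statement (`exists_flowPartition_sub`): a path and a small
perturbation of it can be measured with the same partition and windows, and then their spectral
flows differ only by rank differences at the two end points. If those ranks are even, the parity
does not change. Both claims follow. Two paths of `SymmetricPaths` are joined by a linear homotopy
that stays Fredholm, the differences being compact, and keeps the Kramers symmetry at `0` and `1/2`.
The segment `linePath F U` varies continuously with `(F, U)`, which gives local constancy.

Everything about windows rests on `specRank_sub_specRank_eq`: over a connected family the counts in
`(a, 0]` and `(a', 0]` differ by the rank of a continuous family of projections, hence by a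
constant. It yields independence of the partition as well as the cancellation at interior nodes in
the stability statement. Suitable windows exist since `0` is at most an isolated point of the
spectrum of a self-adjoint Fredholm operator, with finite-dimensional kernel. -/

/-- The range of `χ_{(-∞, c]}(T)`. -/
def specSubspace (T : H →L[ℂ] H) (c : ℝ) : Submodule ℂ H :=
  (cfc (fun x : ℝ => max (x - c) 0) T).ker

instance (T : H →L[ℂ] H) (c : ℝ) : CompleteSpace (specSubspace T c) :=
  inferInstanceAs (CompleteSpace (cfc (fun x : ℝ => max (x - c) 0) T).ker)

theorem specProjIic_eq (T : H →L[ℂ] H) (c : ℝ) :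
    specProjIic T c = (specSubspace T c).starProjection := rfl

theorem mem_specSubspace {T : H →L[ℂ] H} {c : ℝ} {x : H} :
    x ∈ specSubspace T c ↔ cfc (fun x : ℝ => max (x - c) 0) T x = 0 := Iff.rfl

/-- A continuous function with value `1` on `(-∞, c]` and `0` on `[d, ∞)`. -/
def ramp (c d x : ℝ) : ℝ := 1 - max (x - c) 0 / max (x - c) (d - c)

theorem max_sub_pos {c d : ℝ} (h : c < d) (x : ℝ) : 0 < max (x - c) (d - c) :=
  lt_max_of_lt_right (sub_pos.2 h)

theorem continuous_ramp {c d : ℝ} (h : c < d) : Continuous (ramp c d) := by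
  unfold ramp
  exact continuous_const.sub (Continuous.div (by fun_prop) (by fun_prop)
    fun x => (max_sub_pos h x).ne')

theorem ramp_of_le {c d x : ℝ} (h : x ≤ c) : ramp c d x = 1 := by
  simp [ramp, max_eq_right (sub_nonpos.2 h)]

theorem ramp_of_ge {c d x : ℝ} (hcd : c < d) (h : d ≤ x) : ramp c d x = 0 := by
  have h1 : 0 < x - c := by linarith
  rw [ramp, max_eq_left h1.le, max_eq_left (by linarith), div_self h1.ne', sub_self]

/-- The function `(x - d)₊` is a continuous multiple of `(x - c)₊`, so the kernels of the two
positive parts are nested. -/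
theorem specSubspace_mono (T : H →L[ℂ] H) {c d : ℝ} (h : c ≤ d) :
    specSubspace T c ≤ specSubspace T d := by
  rcases h.eq_or_lt with rfl | h
  · exact le_rfl
  intro x hx
  have hg : Continuous fun x : ℝ => max (x - d) 0 / max (x - c) (d - c) :=
    Continuous.div (by fun_prop) (by fun_prop) fun x => (max_sub_pos h x).ne'
  have key : cfc (fun x : ℝ => max (x - d) 0) T =
      cfc (fun x : ℝ => max (x - d) 0 / max (x - c) (d - c)) T *
        cfc (fun x : ℝ => max (x - c) 0) T := by
    rw [← cfc_mul _ _ T hg.continuousOn (by fun_prop)]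
    congr 1
    funext x
    rcases le_total x d with hx | hx
    · simp [max_eq_right (sub_nonpos.2 hx)]
    · have h1 : 0 < x - c := by linarith
      rw [max_eq_left (show d - c ≤ x - c by linarith), max_eq_left h1.le,
        div_mul_cancel₀ _ h1.ne']
  rw [mem_specSubspace] at hx ⊢
  rw [key, mul_apply_eq_comp, hx, map_zero]

theorem isSelfAdjoint_specProjIic (T : H →L[ℂ] H) (c : ℝ) : IsSelfAdjoint (specProjIic T c) := by
  rw [specProjIic_eq]
  exact isSelfAdjoint_starProjection _

theorem specProjIic_mul_of_le (T : H →L[ℂ] H) {c d : ℝ} (h : c ≤ d) :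
    specProjIic T c * specProjIic T d = specProjIic T c :=
  Submodule.starProjection_comp_starProjection_of_le (specSubspace_mono T h)

theorem specProjIic_mul_of_ge (T : H →L[ℂ] H) {c d : ℝ} (h : c ≤ d) :
    specProjIic T d * specProjIic T c = specProjIic T c := by
  have := congrArg star (specProjIic_mul_of_le T h)
  rwa [star_mul, (isSelfAdjoint_specProjIic T c).star_eq,
    (isSelfAdjoint_specProjIic T d).star_eq] at this

/-- A function equal to `1` on `(-∞, c]` acts as the identity on the range of
`χ_{(-∞, c]}(T)`. -/
theorem cfc_ramp_mul_specProjIic {T : H →L[ℂ] H} (hT : IsSelfAdjoint T) {c d : ℝ} (h : c < d) :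
    cfc (ramp c d) T * specProjIic T c = specProjIic T c := by
  have hg : Continuous fun x : ℝ => 1 / max (x - c) (d - c) :=
    Continuous.div (by fun_prop) (by fun_prop) fun x => (max_sub_pos h x).ne'
  -- The function `1 - ramp c d` has the factor `(x - c)₊`, whose operator kills the range of the
  -- projection.
  have key : cfc (ramp c d) T = 1 - cfc (fun x : ℝ => 1 / max (x - c) (d - c)) T *
        cfc (fun x : ℝ => max (x - c) 0) T := by
    rw [← cfc_mul _ _ T hg.continuousOn (by fun_prop), ← cfc_one ℝ T,
      ← cfc_sub _ _ T (by fun_prop) (by fun_prop)]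
    congr 1
    funext x
    simp only [ramp, Pi.one_apply]
    ring
  ext x
  have hx : specProjIic T c x ∈ specSubspace T c := by
    rw [specProjIic_eq]; exact Submodule.starProjection_apply_mem _ _
  rw [mem_specSubspace] at hx
  rw [key, mul_apply_eq_comp, sub_apply,
    mul_apply_eq_comp, hx, map_zero, sub_zero, one_apply_eq_self]

theorem specProjIic_mul_cfc_ramp {T : H →L[ℂ] H} (hT : IsSelfAdjoint T) {c d : ℝ} (h : c < d) :
    specProjIic T c * cfc (ramp c d) T = specProjIic T c := by
  have := congrArg star (cfc_ramp_mul_specProjIic hT h)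
  have hs : IsSelfAdjoint (cfc (ramp c d) T) := cfc_predicate _ _
  rwa [star_mul, (isSelfAdjoint_specProjIic T c).star_eq, hs.star_eq] at this

/-- A function that vanishes on the part of the spectrum in `(c, ∞)` maps into the range of
`χ_{(-∞, c]}(T)`. -/
theorem specProjIic_mul_cfc {T : H →L[ℂ] H} {c : ℝ} {f : ℝ → ℝ}
    (hf : Continuous f) (h0 : ∀ x ∈ spectrum ℝ T, c < x → f x = 0) :
    specProjIic T c * cfc f T = cfc f T := by
  ext x
  rw [specProjIic_eq, mul_apply_eq_comp, Submodule.starProjection_eq_self_iff,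
    mem_specSubspace, ← mul_apply_eq_comp,
    ← cfc_mul _ _ T (by fun_prop) (by fun_prop)]
  rw [cfc_congr (g := fun _ => 0)]
  · simp
  · intro y hy
    rcases le_or_gt y c with h | h
    · simp [max_eq_right (sub_nonpos.2 h)]
    · simp [h0 y hy h]

theorem cfc_mul_specProjIic {T : H →L[ℂ] H} {c : ℝ} {f : ℝ → ℝ}
    (hf : Continuous f) (h0 : ∀ x ∈ spectrum ℝ T, c < x → f x = 0) :
    cfc f T * specProjIic T c = cfc f T := by
  have := congrArg star (specProjIic_mul_cfc hf h0)
  have hs : IsSelfAdjoint (cfc f T) := cfc_predicate _ _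
  rwa [star_mul, (isSelfAdjoint_specProjIic T c).star_eq, hs.star_eq] at this

/-- In a spectral gap the spectral projection is given by the continuous functional calculus. -/
theorem specProjIic_eq_cfc {T : H →L[ℂ] H} (hT : IsSelfAdjoint T) {c d : ℝ} (h : c < d)
    (hgap : Disjoint (spectrum ℝ T) (Icc c d)) : specProjIic T c = cfc (ramp c d) T := by
  rw [← specProjIic_mul_cfc_ramp hT h, specProjIic_mul_cfc (continuous_ramp h)]
  intro x hx hcx
  refine ramp_of_ge h (le_of_not_ge fun hxd => ?_)
  exact Set.disjoint_left.1 hgap hx ⟨hcx.le, hxd⟩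

theorem specProj_mul_specProj (T : H →L[ℂ] H) {a b c d : ℝ}
    (hac : a ≤ c) (hcd : c ≤ d) (hdb : d ≤ b) :
    specProj T a b * specProj T c d = specProj T c d := by
  unfold specProj
  rw [sub_mul, mul_sub, mul_sub, specProjIic_mul_of_ge T hdb,
    specProjIic_mul_of_ge T (hcd.trans hdb), specProjIic_mul_of_le T (hac.trans hcd),
    specProjIic_mul_of_le T hac]
  abel

theorem isIdempotentElem_specProj (T : H →L[ℂ] H) {a b : ℝ}
    (hab : a ≤ b) : IsIdempotentElem (specProj T a b) :=
  specProj_mul_specProj T le_rfl hab le_rfl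

theorem specProj_mul_eq_zero (T : H →L[ℂ] H) {a b c : ℝ}
    (hab : a ≤ b) (hbc : b ≤ c) :
    specProj T a b * specProj T b c = 0 := by
  unfold specProj
  rw [sub_mul, mul_sub, mul_sub, specProjIic_mul_of_le T hbc, specProjIic_mul_of_le T le_rfl,
    specProjIic_mul_of_le T (hab.trans hbc), specProjIic_mul_of_le T hab]
  abel

theorem specProj_add (T : H →L[ℂ] H) (a b c : ℝ) :
    specProj T a b + specProj T b c = specProj T a c := by
  unfold specProj; abel

theorem specProj_range_le (T : H →L[ℂ] H) {a b c d : ℝ}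
    (hac : a ≤ c) (hcd : c ≤ d) (hdb : d ≤ b) :
    (specProj T c d).range ≤ (specProj T a b).range := by
  rintro _ ⟨x, rfl⟩
  exact ⟨specProj T c d x, congrArg (· x) (specProj_mul_specProj T hac hcd hdb)⟩

theorem finiteDimensional_specProj (T : H →L[ℂ] H) {a b c d : ℝ}
    (hac : a ≤ c) (hcd : c ≤ d) (hdb : d ≤ b) [FiniteDimensional ℂ (specProj T a b).range] :
    FiniteDimensional ℂ (specProj T c d).range :=
  Submodule.finiteDimensional_of_le (specProj_range_le T hac hcd hdb)

theorem specRank_add (T : H →L[ℂ] H) {a b c : ℝ} (hab : a ≤ b)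
    (hbc : b ≤ c) [FiniteDimensional ℂ (specProj T a c).range] :
    specRank T a c = specRank T a b + specRank T b c := by
  have h1 := finiteDimensional_specProj T le_rfl hab hbc
  have h2 := finiteDimensional_specProj T hab hbc le_rfl
  have hinf : (specProj T a b).range ⊓ (specProj T b c).range = ⊥ := by
    rw [eq_bot_iff]
    rintro _ ⟨⟨x, rfl⟩, y, hy⟩
    have e1 := congrArg (· x) (isIdempotentElem_specProj T hab).eq
    have e2 := congrArg (· y) (specProj_mul_eq_zero T hab hbc)
    simp only [mul_apply_eq_comp, zero_apply] at e1 e2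
    change specProj T b c y = specProj T a b x at hy
    rw [hy, e1] at e2
    exact e2
  have hsup : (specProj T a b).range ⊔ (specProj T b c).range = (specProj T a c).range := by
    apply le_antisymm
    · exact sup_le (specProj_range_le T le_rfl hab hbc) (specProj_range_le T hab hbc le_rfl)
    · rintro _ ⟨x, rfl⟩
      rw [← specProj_add T a b c]
      exact Submodule.add_mem_sup ⟨x, rfl⟩ ⟨x, rfl⟩
  have := Submodule.finrank_sup_add_finrank_inf_eq (specProj T a b).range (specProj T b c).range
  rw [hinf, hsup, finrank_bot, add_zero] at this
  exact this

/-! ### Ranks of continuous families of projections -/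

omit [CompleteSpace H] in
-- `Q` is injective on the range of `P`: if `P v = v` and `Q v = 0`, then `‖v‖ = ‖(P - Q) v‖`, which
-- forces `v = 0`. Finiteness of rank thus passes to nearby projections.
theorem finrank_range_le_of_norm_sub_lt_one {P Q : H →L[ℂ] H} (hP : IsIdempotentElem P)
    (h : ‖P - Q‖ < 1) [FiniteDimensional ℂ Q.range] :
    FiniteDimensional ℂ P.range ∧ Module.finrank ℂ P.range ≤ Module.finrank ℂ Q.range := by
  let f : P.range →ₗ[ℂ] Q.range := Q.toLinearMap.rangeRestrict.domRestrict P.range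
  have hf : Function.Injective f := by
    rw [injective_iff_map_eq_zero]
    rintro ⟨_, x, rfl⟩ hx
    have hx' : Q (P x) = 0 := congrArg Subtype.val hx
    have hpp : P (P x) = P x := congrArg (· x) hP.eq
    have : ‖P x‖ ≤ ‖P - Q‖ * ‖P x‖ := by
      have := (P - Q).le_opNorm (P x)
      rwa [sub_apply, hx', hpp, sub_zero] at this
    have h0 : P x = 0 := by
      by_contra hne
      have := norm_pos_iff.2 hne
      nlinarith
    exact Subtype.ext h0
  exact ⟨FiniteDimensional.of_injective f hf, LinearMap.finrank_le_finrank_of_injective hf⟩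

omit [CompleteSpace H] in
theorem finrank_range_eq_of_norm_sub_lt_one {P Q : H →L[ℂ] H} (hP : IsIdempotentElem P)
    (hQ : IsIdempotentElem Q) (h : ‖P - Q‖ < 1) [FiniteDimensional ℂ P.range]
    [FiniteDimensional ℂ Q.range] :
    Module.finrank ℂ P.range = Module.finrank ℂ Q.range :=
  le_antisymm (finrank_range_le_of_norm_sub_lt_one hP h).2
    (finrank_range_le_of_norm_sub_lt_one hQ (by rwa [norm_sub_rev])).2

omit [CompleteSpace H] in
theorem finrank_range_eq_of_isPreconnected {X : Type*} [TopologicalSpace X] {S : Set X}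
    (hS : IsPreconnected S) {E : X → H →L[ℂ] H} (hE : ContinuousOn E S)
    (hid : ∀ x ∈ S, IsIdempotentElem (E x)) (hfin : ∀ x ∈ S, FiniteDimensional ℂ (E x).range)
    {x y : X} (hx : x ∈ S) (hy : y ∈ S) :
    Module.finrank ℂ (E x).range = Module.finrank ℂ (E y).range := by
  refine hS.constant (f := fun x => Module.finrank ℂ (E x).range) ?_ hx hy
  intro z hz
  refine tendsto_nhds_of_eventually_eq ?_
  have := (hE z hz).eventually (Metric.ball_mem_nhds (E z) one_pos)
  filter_upwards [this, self_mem_nhdsWithin] with w hw hwS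
  have := hfin z hz
  have := hfin w hwS
  exact finrank_range_eq_of_norm_sub_lt_one (hid w hwS) (hid z hz) (by simpa [dist_eq_norm] using hw)

theorem continuousOn_cfc_of_continuous {X : Type*} [TopologicalSpace X] {S : Set X}
    {T : X → H →L[ℂ] H} (hT : ContinuousOn T S) (hsa : ∀ x ∈ S, IsSelfAdjoint (T x))
    {f : ℝ → ℝ} (hf : Continuous f) : ContinuousOn (fun x => cfc f (T x)) S :=
  ContinuousOn.cfc_of_mem_nhdsSet f (s := univ) univ_mem hT hsa hf.continuousOn

/-- Moving the lower end of a spectral window changes the number of nonpositive eigenvalues in the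
window by a constant, along families on which both spectral projections are continuous. -/
theorem specRank_sub_specRank_eq {X : Type*} [TopologicalSpace X] {S : Set X}
    (hS : IsPreconnected S) {T : X → H →L[ℂ] H} (hT : ContinuousOn T S)
    (hsa : ∀ x ∈ S, IsSelfAdjoint (T x)) {a b a' b' : ℝ} (ha : a < 0) (hb : 0 < b) (ha' : a' < 0)
    (hb' : 0 < b') (hc : ContinuousOn (fun x => specProj (T x) a b) S)
    (hc' : ContinuousOn (fun x => specProj (T x) a' b') S)
    (hfin : ∀ x ∈ S, FiniteDimensional ℂ (specProj (T x) a b).range)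
    (hfin' : ∀ x ∈ S, FiniteDimensional ℂ (specProj (T x) a' b').range)
    {x y : X} (hx : x ∈ S) (hy : y ∈ S) :
    (specRank (T x) a 0 : ℤ) - specRank (T x) a' 0 =
      specRank (T y) a 0 - specRank (T y) a' 0 := by
  wlog h : a ≤ a' generalizing a a' b b'
  · have := this ha' hb' ha hb hc' hc hfin' hfin (le_of_not_ge h)
    lia
  have hE : ContinuousOn (fun x => specProj (T x) a a') S := by
    -- Neither `a` nor `a'` need lie in a spectral gap, so the projections `χ_{(-∞, a]}` and
    -- `χ_{(-∞, a']}` need not be continuous separately. Multiplying the difference of the two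
    -- window projections by a ramp supported below `0` cancels the upper ends `b`, `b'` and fixes
    -- the lower ends, which leaves `χ_{(a, a']}`.
    refine ((continuousOn_cfc_of_continuous hT hsa (continuous_ramp ha')).mul
      (hc.sub hc')).congr fun z hz => ?_
    have hr : ∀ c : ℝ, 0 < c →
        cfc (ramp a' 0) (T z) * specProjIic (T z) c = cfc (ramp a' 0) (T z) := fun c h0c =>
      cfc_mul_specProjIic (continuous_ramp ha') fun t _ ht => ramp_of_ge ha' (h0c.trans ht).le
    have ha1 : cfc (ramp a' 0) (T z) * specProjIic (T z) a = specProjIic (T z) a := by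
      rw [← specProjIic_mul_of_ge (T z) h, ← mul_assoc,
        cfc_ramp_mul_specProjIic (hsa z hz) ha']
    simp only [Pi.mul_apply, Pi.sub_apply, specProj, mul_sub, hr b hb, hr b' hb', ha1,
      cfc_ramp_mul_specProjIic (hsa z hz) ha']
    abel
  have hrank : ∀ z ∈ S, (specRank (T z) a 0 : ℤ) - specRank (T z) a' 0 = specRank (T z) a a' := by
    intro z hz
    have := hfin z hz
    have := finiteDimensional_specProj (T z) le_rfl ha.le hb.le
    rw [specRank_add (T z) h ha'.le]
    push_cast
    ring
  rw [hrank x hx, hrank y hy]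
  norm_cast
  refine finrank_range_eq_of_isPreconnected hS hE
    (fun z hz => isIdempotentElem_specProj (T z) h) (fun z hz => ?_) hx hy
  have := hfin z hz
  exact finiteDimensional_specProj (T z) le_rfl h (ha'.trans hb).le

/-! ### Independence of the partition -/

theorem sum_castSucc_sub_succ {N : ℕ} (f : Fin (N + 1) → ℤ) :
    ∑ n : Fin N, (f n.castSucc - f n.succ) = f 0 - f (Fin.last N) := by
  induction N with
  | zero => simp
  | succ N ih =>
    rw [Fin.sum_univ_castSucc]
    have := ih fun i => f i.castSucc
    simp only [Fin.castSucc_zero] at this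
    simp only [← Fin.castSucc_succ] at this ⊢
    rw [this, Fin.succ_last]
    ring

namespace FlowPartition

variable {F : ℝ → H →L[ℂ] H} {α β : ℝ}

theorem le_s (P : FlowPartition F α β) (i : Fin (P.N + 1)) : α ≤ P.s i :=
  P.s_first.symm.trans_le (P.s_mono.monotone (Fin.zero_le i))

theorem s_le (P : FlowPartition F α β) (i : Fin (P.N + 1)) : P.s i ≤ β :=
  (P.s_mono.monotone (Fin.le_last i)).trans_eq P.s_last

theorem s_lt (P : FlowPartition F α β) (n : Fin P.N) : P.s n.castSucc < P.s n.succ :=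
  P.s_mono n.castSucc_lt_succ

/-- The number of eigenvalues in the `n`-th window below zero. -/
def windowRank (P : FlowPartition F α β) (n : Fin P.N) (t : ℝ) : ℤ := specRank (F t) (P.a n) 0

/-- The projection of the line onto the `n`-th interval. -/
def clamp (P : FlowPartition F α β) (n : Fin P.N) (t : ℝ) : ℝ :=
  max (P.s n.castSucc) (min t (P.s n.succ))

/-- Clamping the nodes of `Q` into an interval of `P` subdivides that interval, and nodes outside
collapse to an end and contribute zero. The inner sum telescopes. This replaces the construction of
a common refinement. -/
theorem value_eq_sum_sum (P Q : FlowPartition F α β) :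
    P.value = ∑ n, ∑ k : Fin Q.N, (P.windowRank n (P.clamp n (Q.s k.castSucc)) -
      P.windowRank n (P.clamp n (Q.s k.succ))) := by
  refine Finset.sum_congr rfl fun n _ => ?_
  rw [sum_castSucc_sub_succ fun i => P.windowRank n (P.clamp n (Q.s i)), Q.s_first, Q.s_last]
  have h1 : P.clamp n α = P.s n.castSucc := max_eq_left ((min_le_left _ _).trans (P.le_s _))
  have h2 : P.clamp n β = P.s n.succ := by
    rw [clamp, min_eq_right (P.s_le _), max_eq_right (P.s_lt n).le]
  rw [h1, h2]
  rfl

/-- Each side is the change of a count over the overlap of the two intervals. Without overlap both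
vanish; on an overlap both windows are continuous and `specRank_sub_specRank_eq` applies. -/
theorem windowRank_sub_eq (P Q : FlowPartition F α β) (hF : ContinuousOn F (Icc α β))
    (hsa : ∀ t ∈ Icc α β, IsSelfAdjoint (F t)) (n : Fin P.N) (k : Fin Q.N) :
    P.windowRank n (P.clamp n (Q.s k.castSucc)) - P.windowRank n (P.clamp n (Q.s k.succ)) =
      Q.windowRank k (Q.clamp k (P.s n.castSucc)) - Q.windowRank k (Q.clamp k (P.s n.succ)) := by
  have hP := P.s_lt n
  have hQ := Q.s_lt k
  have hPα := P.le_s n.castSucc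
  have hPβ := P.s_le n.succ
  have hPn := P.continuousOn n
  have hPf := P.finite_rank n
  have hQk := Q.continuousOn k
  have hQf := Q.finite_rank k
  unfold clamp
  generalize P.s n.castSucc = l at *
  generalize P.s n.succ = r at *
  generalize Q.s k.castSucc = l' at *
  generalize Q.s k.succ = r' at *
  rcases lt_or_ge r l' with h | h
  · rw [min_eq_right h.le, min_eq_right (h.trans hQ).le, min_eq_left (hP.trans (h.trans hQ)).le,
      min_eq_left (h.trans hQ).le, max_eq_left h.le, max_eq_left (hP.trans h).le, sub_self, sub_self]
  rcases lt_or_ge r' l with h' | h'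
  · rw [min_eq_right h'.le, min_eq_right (h'.trans hP).le, min_eq_left (hQ.trans (h'.trans hP)).le,
      min_eq_left (h'.trans hP).le, max_eq_left h'.le, max_eq_left (hQ.trans h').le, sub_self,
      sub_self]
  have hle : max l l' ≤ min r r' := max_le (le_min hP.le h') (le_min h hQ.le)
  rw [min_eq_left h, min_eq_left h', max_comm l' l, min_comm r' r,
    max_eq_right ((le_max_left l l').trans hle), max_eq_right ((le_max_right l l').trans hle)]
  have hsub : Icc (max l l') (min r r') ⊆ Icc l r :=
    Icc_subset_Icc (le_max_left _ _) (min_le_left _ _)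
  have hsub' : Icc (max l l') (min r r') ⊆ Icc l' r' :=
    Icc_subset_Icc (le_max_right _ _) (min_le_right _ _)
  have hsub'' : Icc (max l l') (min r r') ⊆ Icc α β := hsub.trans (Icc_subset_Icc hPα hPβ)
  have := specRank_sub_specRank_eq isPreconnected_Icc (hF.mono hsub'')
    (fun t ht => hsa t (hsub'' ht)) (P.a_mem n).2 (P.b_mem n).1 (Q.a_mem k).2 (Q.b_mem k).1
    (hPn.mono hsub) (hQk.mono hsub') (fun t ht => hPf t (hsub ht)) (fun t ht => hQf t (hsub' ht))
    (left_mem_Icc.2 hle) (right_mem_Icc.2 hle)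
  unfold windowRank
  linarith

theorem value_eq_value (P Q : FlowPartition F α β) (hF : ContinuousOn F (Icc α β))
    (hsa : ∀ t ∈ Icc α β, IsSelfAdjoint (F t)) : P.value = Q.value := by
  rw [P.value_eq_sum_sum Q, Q.value_eq_sum_sum P, Finset.sum_comm]
  exact Finset.sum_congr rfl fun k _ => Finset.sum_congr rfl fun n _ =>
    P.windowRank_sub_eq Q hF hsa n k

theorem spectralFlow_eq (P : FlowPartition F α β) (hF : ContinuousOn F (Icc α β))
    (hsa : ∀ t ∈ Icc α β, IsSelfAdjoint (F t)) : spectralFlow F α β = P.value := by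
  have h : ∃ k, HasSpectralFlow F α β k := ⟨_, P, rfl⟩
  rw [spectralFlow, dif_pos h]
  obtain ⟨Q, hQ⟩ := h.choose_spec
  rw [← hQ, Q.value_eq_value P hF hsa]

end FlowPartition

theorem existsUnique_hasSpectralFlow {F : ℝ → H →L[ℂ] H} {α β : ℝ} (P : FlowPartition F α β)
    (hF : ContinuousOn F (Icc α β)) (hsa : ∀ t ∈ Icc α β, IsSelfAdjoint (F t)) :
    ∃! k, HasSpectralFlow F α β k := by
  refine ⟨P.value, ⟨P, rfl⟩, ?_⟩
  rintro _ ⟨Q, rfl⟩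
  exact Q.value_eq_value P hF hsa

/-! ### Self-adjoint Fredholm operators -/

omit [CompleteSpace H] in
theorem isCompactOperator_of_finiteDimensional_range (T : H →L[ℂ] H)
    [FiniteDimensional ℂ T.range] : IsCompactOperator T := by
  have : LocallyCompactSpace T.range := LocallyCompactSpace.of_finiteDimensional_of_complete ℂ _
  have h := IsCompactOperator.comp_clm
    (isCompactOperator_of_locallyCompactSpace_rng (T.range.subtypeL)) T.rangeRestrict
  exact h

/-- On the kernel of `A` the compact operator `-K` is the identity, so Riesz's theorem applies. -/
theorem finiteDimensional_ker_of_mul_eq {V A K : H →L[ℂ] H} (h : V * A = 1 + K)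
    (hK : IsCompactOperator K) : FiniteDimensional ℂ A.ker := by
  have hker : ∀ x ∈ A.ker, (-K) x = x := by
    intro x hx
    have := congrArg (· x) h
    simp only [mul_apply_eq_comp, add_apply, one_apply_eq_self] at this
    rw [show A x = 0 from hx, map_zero] at this
    rw [neg_apply, neg_eq_iff_add_eq_zero, add_comm, ← this]
  have hc : IsCompactOperator ((-K : H →L[ℂ] H) : H →ₗ[ℂ] H) := hK.neg
  have hmem : ∀ x ∈ A.ker, ((-K : H →L[ℂ] H) : H →ₗ[ℂ] H) x ∈ A.ker := fun x hx => by
    rw [ContinuousLinearMap.coe_coe, hker x hx]; exact hx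
  have := hc.restrict' hmem
  have hid : ⇑(((-K : H →L[ℂ] H) : H →ₗ[ℂ] H).restrict hmem) = id :=
    funext fun x => Subtype.ext (hker x x.2)
  rw [hid] at this
  exact FiniteDimensional.of_isCompactOperator_id this

omit [CompleteSpace H] in
-- Otherwise there are unit vectors `x n` orthogonal to the kernel with `A (x n) → 0`. Since `x n =
-- V (A (x n)) - K (x n)`, a subsequence converges, and its limit is a unit vector lying both in the
-- kernel and in its orthogonal complement.
theorem exists_le_norm_of_mul_eq {V A K : H →L[ℂ] H} (h : V * A = 1 + K)
    (hK : IsCompactOperator K) : ∃ c > 0, ∀ x ∈ A.kerᗮ, c * ‖x‖ ≤ ‖A x‖ := by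
  by_contra! hcon
  have hex : ∀ n : ℕ, ∃ x ∈ A.kerᗮ, ‖x‖ = 1 ∧ ‖A x‖ < 1 / ((n : ℝ) + 1) := by
    intro n
    obtain ⟨x, hx, hlt⟩ := hcon (1 / ((n : ℝ) + 1)) (by positivity)
    have hx0 : 0 < ‖x‖ := by
      by_contra h0
      have : x = 0 := by simpa using h0
      simp [this] at hlt
    refine ⟨((‖x‖⁻¹ : ℝ) : ℂ) • x, Submodule.smul_mem _ _ hx, ?_, ?_⟩
    · rw [norm_smul, Complex.norm_real, norm_inv, norm_norm, inv_mul_cancel₀ hx0.ne']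
    · rw [map_smul, norm_smul, Complex.norm_real, norm_inv, norm_norm, inv_mul_lt_iff₀ hx0,
        mul_comm]
      exact hlt
  choose x hxk hx1 hxA using hex
  have hA0 : Tendsto (fun n => A (x n)) atTop (𝓝 0) :=
    squeeze_zero_norm (fun n => (hxA n).le) tendsto_one_div_add_atTop_nhds_zero_nat
  obtain ⟨S, hS, hKS⟩ := IsCompactOperator.image_closedBall_subset_compact (f := K.toLinearMap) hK 1
  obtain ⟨y, -, φ, hφ, hy⟩ := hS.tendsto_subseq (x := fun n => K (x n)) fun n =>
    hKS ⟨x n, by simp [hx1], rfl⟩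
  have hxV : ∀ n, x n = V (A (x n)) - K (x n) := by
    intro n
    have := congrArg (· (x n)) h
    simp only [mul_apply_eq_comp, add_apply, one_apply_eq_self] at this
    rw [this, add_sub_cancel_right]
  have hlim : Tendsto (fun n => x (φ n)) atTop (𝓝 (-y)) := by
    have h1 : Tendsto (fun n => V (A (x (φ n)))) atTop (𝓝 (V 0)) :=
      (V.continuous.tendsto 0).comp (hA0.comp hφ.tendsto_atTop)
    have := h1.sub hy
    rw [map_zero, zero_sub] at this
    exact this.congr fun n => (hxV (φ n)).symm
  have hker : -y ∈ A.ker :=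
    tendsto_nhds_unique ((A.continuous.tendsto _).comp hlim) (hA0.comp hφ.tendsto_atTop)
  have hort : -y ∈ A.kerᗮ :=
    A.ker.isClosed_orthogonal.mem_of_tendsto hlim (Eventually.of_forall fun n => hxk _)
  have hn : ‖-y‖ = 1 := tendsto_nhds_unique hlim.norm (by simp [hx1])
  have h0 := Submodule.inner_right_of_mem_orthogonal hker hort
  rw [inner_self_eq_zero] at h0
  simp [h0] at hn

/-- A self-adjoint operator which is bounded below is invertible. -/
theorem isUnit_of_le_norm {B : H →L[ℂ] H} (hB : IsSelfAdjoint B) {c : ℝ} (hc : 0 < c)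
    (h : ∀ x, c * ‖x‖ ≤ ‖B x‖) : IsUnit B := by
  rw [ContinuousLinearMap.isUnit_iff_bijective, ContinuousLinearMap.bijective_iff_dense_range_and_antilipschitz]
  constructor
  · rw [Submodule.topologicalClosure_eq_top_iff, ContinuousLinearMap.orthogonal_range,
      hB.adjoint_eq, eq_bot_iff]
    intro x hx
    have := h x
    rw [show B x = 0 from hx, norm_zero] at this
    have : ‖x‖ ≤ 0 := by nlinarith [norm_nonneg x]
    simpa using this
  · refine ⟨c⁻¹.toNNReal, ContinuousLinearMap.antilipschitz_of_bound _ fun x => ?_⟩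
    rw [Real.coe_toNNReal _ (inv_nonneg.2 hc.le), inv_mul_eq_div, le_div_iff₀ hc, mul_comm]
    exact h x

omit [CompleteSpace H] in
/-- A lower bound for an operator which is reduced by a decomposition of the space. -/
theorem le_norm_of_reduces {B : H →L[ℂ] H} {K : Submodule ℂ H} [K.HasOrthogonalProjection] {c : ℝ}
    (hc : 0 ≤ c) (hK : ∀ x ∈ K, B x ∈ K ∧ c * ‖x‖ ≤ ‖B x‖)
    (hK' : ∀ x ∈ Kᗮ, B x ∈ Kᗮ ∧ c * ‖x‖ ≤ ‖B x‖) (x : H) : c * ‖x‖ ≤ ‖B x‖ := by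
  obtain ⟨y, hy, z, hz, rfl⟩ := K.exists_add_mem_mem_orthogonal x
  obtain ⟨hBy, hcy⟩ := hK y hy
  obtain ⟨hBz, hcz⟩ := hK' z hz
  have h1 := norm_add_sq_eq_norm_sq_add_norm_sq_of_inner_eq_zero (𝕜 := ℂ) y z
    (Submodule.inner_right_of_mem_orthogonal hy hz)
  have h2 := norm_add_sq_eq_norm_sq_add_norm_sq_of_inner_eq_zero (𝕜 := ℂ) (B y) (B z)
    (Submodule.inner_right_of_mem_orthogonal hBy hBz)
  rw [map_add]
  refine le_of_sq_le_sq ?_ (norm_nonneg _)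
  have h3 : (c * ‖y‖) ^ 2 ≤ ‖B y‖ ^ 2 := pow_le_pow_left₀ (by positivity) hcy 2
  have h4 : (c * ‖z‖) ^ 2 ≤ ‖B z‖ ^ 2 := pow_le_pow_left₀ (by positivity) hcz 2
  have h5 : (c * ‖y + z‖) ^ 2 = (c * ‖y‖) ^ 2 + (c * ‖z‖) ^ 2 := by
    rw [mul_pow, pow_two ‖y + z‖, h1]; ring
  rw [h5, pow_two ‖B y + B z‖, h2]
  linarith

theorem map_mem_orthogonal_ker {A : H →L[ℂ] H} (hA : IsSelfAdjoint A) (x : H) :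
    A x ∈ A.kerᗮ := by
  rw [Submodule.mem_orthogonal]
  intro u hu
  have := (ContinuousLinearMap.isSelfAdjoint_iff_isSymmetric.1 hA) u x
  simp only [ContinuousLinearMap.coe_coe] at this
  rw [← this, show A u = 0 from hu, inner_zero_left]

open scoped LinearMap.FiniteRangeSetoid in
-- Adding the projection onto the kernel makes `A` bounded below, hence invertible; the inverse
-- inverts `A` up to finite rank on both sides.
theorem isFredholm_of_le_norm {A : H →L[ℂ] H} (hA : IsSelfAdjoint A) [FiniteDimensional ℂ A.ker]
    {c : ℝ} (hc : 0 < c) (h : ∀ x ∈ A.kerᗮ, c * ‖x‖ ≤ ‖A x‖) : A.IsFredholm := by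
  set P : H →L[ℂ] H := A.ker.starProjection with hP
  have hAP : A * P = 0 := by
    ext x
    exact (A.ker.starProjection_apply_mem x : _)
  have hsa : IsSelfAdjoint P := isSelfAdjoint_starProjection _
  have hPA : P * A = 0 := by
    have := congrArg star hAP
    rwa [star_mul, hA.star_eq, hsa.star_eq, star_zero] at this
  obtain ⟨w, hw⟩ := isUnit_of_le_norm (B := A + P) (hA.add hsa) (lt_min hc one_pos)
    (le_norm_of_reduces (K := A.ker) (lt_min hc one_pos).le (fun x hx => by
      have : (A + P) x = x := by
        rw [add_apply, show A x = 0 from hx, zero_add, hP,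
          Submodule.starProjection_eq_self_iff.2 hx]
      rw [this]
      exact ⟨hx, mul_le_of_le_one_left (norm_nonneg _) (min_le_right _ _)⟩) fun x hx => by
      have : (A + P) x = A x := by
        rw [add_apply, hP, (Submodule.starProjection_apply_eq_zero_iff _).2 hx, add_zero]
      rw [this]
      exact ⟨map_mem_orthogonal_ker hA x,
        (mul_le_mul_of_nonneg_right (min_le_left _ _) (norm_nonneg _)).trans (h x hx)⟩)
  have hfin : P.toLinearMap.HasFiniteRange := by
    rw [LinearMap.HasFiniteRange, hP, Submodule.range_starProjection]
    exact (Submodule.fg_iff_finiteDimensional _).2 inferInstance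
  refine ContinuousLinearMap.IsFredholm.of_isQuasiInverse (v := (↑w⁻¹ : H →L[ℂ] H)) ⟨?_, ?_⟩
  · rw [LinearMap.IsLeftQuasiInverse, LinearMap.FiniteRangeSetoid.equiv_iff_hasFiniteRange]
    have h1 : (↑w⁻¹ : H →L[ℂ] H) * A - 1 = -((↑w⁻¹ : H →L[ℂ] H) * P) := by
      rw [← w.inv_mul, hw]; noncomm_ring
    have h2 := congrArg ContinuousLinearMap.toLinearMap h1
    exact (congrArg LinearMap.HasFiniteRange h2).mpr (hfin.comp_left _).neg
  · rw [LinearMap.IsRightQuasiInverse, LinearMap.FiniteRangeSetoid.equiv_iff_hasFiniteRange]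
    have h1 : A * (↑w⁻¹ : H →L[ℂ] H) - 1 = -(P * (↑w⁻¹ : H →L[ℂ] H)) := by
      rw [← w.mul_inv, hw]; noncomm_ring
    have h2 := congrArg ContinuousLinearMap.toLinearMap h1
    exact (congrArg LinearMap.HasFiniteRange h2).mpr (hfin.comp_right _).neg

omit [CompleteSpace H] in
open scoped LinearMap.FiniteRangeSetoid in
theorem exists_mul_eq_one_add_compact {A : H →L[ℂ] H} (hA : A.IsFredholm) :
    ∃ V K : H →L[ℂ] H, V * A = 1 + K ∧ IsCompactOperator K := by
  obtain ⟨V, hV, -⟩ := hA.exists_isQuasiInverse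
  rw [LinearMap.IsLeftQuasiInverse, LinearMap.FiniteRangeSetoid.equiv_iff_hasFiniteRange] at hV
  refine ⟨V, V * A - 1, by abel, ?_⟩
  have : FiniteDimensional ℂ (V * A - 1).range := (Submodule.fg_iff_finiteDimensional _).1 hV
  exact isCompactOperator_of_finiteDimensional_range _

/-- A left inverse of `A` modulo compacts is also one for `A + K`. By self-adjointness this
one-sided information suffices. -/
theorem isFredholm_add_compact {A K : H →L[ℂ] H} (hA : IsSelfAdjoint A) (hF : A.IsFredholm)
    (hK : IsSelfAdjoint K) (hc : IsCompactOperator K) : (A + K).IsFredholm := by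
  obtain ⟨V, L, hV, hL⟩ := exists_mul_eq_one_add_compact hF
  have h : V * (A + K) = 1 + (L + V * K) := by rw [mul_add, hV, add_assoc]
  have hcomp : IsCompactOperator (L + V * K) := hL.add (hc.clm_comp V)
  have := finiteDimensional_ker_of_mul_eq h hcomp
  obtain ⟨c, hc0, hle⟩ := exists_le_norm_of_mul_eq h hcomp
  exact isFredholm_of_le_norm (hA.add hK) hc0 hle

omit [CompleteSpace H] in
theorem isFredholm_of_isUnit {A : H →L[ℂ] H} (h : IsUnit A) : A.IsFredholm := by
  obtain ⟨w, rfl⟩ := h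
  refine ContinuousLinearMap.IsFredholm.of_isQuasiInverse (v := (↑w⁻¹ : H →L[ℂ] H)) ⟨?_, ?_⟩
  · have : (↑w⁻¹ : H →L[ℂ] H).toLinearMap ∘ₗ (w : H →L[ℂ] H).toLinearMap = LinearMap.id :=
      congrArg ContinuousLinearMap.toLinearMap w.inv_mul
    rw [LinearMap.IsLeftQuasiInverse, this]
  · have : (w : H →L[ℂ] H).toLinearMap ∘ₗ (↑w⁻¹ : H →L[ℂ] H).toLinearMap = LinearMap.id :=
      congrArg ContinuousLinearMap.toLinearMap w.mul_inv
    rw [LinearMap.IsRightQuasiInverse, this]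

omit [CompleteSpace H] in
theorem essSpectrum_subset_spectrum (T : H →L[ℂ] H) : essSpectrum T ⊆ spectrum ℂ T := by
  intro z hz
  by_contra h
  rw [spectrum.notMem_iff, Algebra.algebraMap_eq_smul_one] at h
  exact hz (isFredholm_of_isUnit (by simpa using h.neg))

/-- For real `z` the shifted operator is still self-adjoint; for other `z` it is invertible. -/
theorem isFredholm_add_compact_sub {T K : H →L[ℂ] H} (hT : IsSelfAdjoint T)
    (hK : IsSelfAdjoint K) (hc : IsCompactOperator K) {z : ℂ}
    (h : (T - z • (1 : H →L[ℂ] H)).IsFredholm) : (T + K - z • (1 : H →L[ℂ] H)).IsFredholm := by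
  by_cases hz : z.im = 0
  · obtain ⟨r, rfl⟩ : ∃ r : ℝ, z = r := ⟨z.re, Complex.ext rfl (by simpa using hz)⟩
    have hsa : IsSelfAdjoint ((r : ℂ) • (1 : H →L[ℂ] H)) := by
      rw [IsSelfAdjoint, star_smul, star_one, Complex.star_def, Complex.conj_ofReal]
    rw [add_sub_right_comm]
    exact isFredholm_add_compact (hT.sub hsa) h hK hc
  · by_contra hcon
    exact hz ((hT.add hK).im_eq_zero_of_mem_spectrum (essSpectrum_subset_spectrum _ hcon))

theorem essSpectrum_add_compact {T K : H →L[ℂ] H} (hT : IsSelfAdjoint T)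
    (hK : IsSelfAdjoint K) (hc : IsCompactOperator K) : essSpectrum (T + K) = essSpectrum T := by
  ext z
  refine not_congr ⟨fun h => ?_, isFredholm_add_compact_sub hT hK hc⟩
  simpa using isFredholm_add_compact_sub (hT.add hK) hK.neg hc.neg h

/-- Zero is at most an isolated eigenvalue of finite multiplicity of a self-adjoint Fredholm
operator. -/
theorem exists_spectral_gap {A : H →L[ℂ] H} (hA : IsSelfAdjoint A) (hF : A.IsFredholm) :
    FiniteDimensional ℂ A.ker ∧ ∃ c > 0, c < 1 ∧ ∀ t ∈ spectrum ℝ A, |t| < c → t = 0 := by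
  obtain ⟨V, L, hV, hL⟩ := exists_mul_eq_one_add_compact hF
  refine ⟨finiteDimensional_ker_of_mul_eq hV hL, ?_⟩
  obtain ⟨c, hc, hle⟩ := exists_le_norm_of_mul_eq hV hL
  -- The cap `1 / 2` keeps the gap below `1`, so that windows chosen inside it lie in `(-1, 1)`.
  refine ⟨min c (1 / 2), lt_min hc (by norm_num), by
    linarith [min_le_right c (1 / 2 : ℝ)], fun t ht htc => ?_⟩
  by_contra h0
  refine ht ?_
  have htc' : |t| < c := htc.trans_le (min_le_left _ _)
  -- Lower bounds for `t - A`: it is multiplication by `t` on the kernel, and on the complement `‖A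
  -- x‖ ≥ c ‖x‖` leaves `c - |t|`.
  have hpos : 0 < min |t| (c - |t|) := lt_min (abs_pos.2 h0) (sub_pos.2 htc')
  have happ : ∀ x, (algebraMap ℝ (H →L[ℂ] H) t - A) x = (t : ℂ) • x - A x := fun x => by
    rw [Algebra.algebraMap_eq_smul_one, sub_apply]
    simp
  have hn : ∀ x : H, ‖(t : ℂ) • x‖ = |t| * ‖x‖ := fun x => by
    rw [norm_smul, Complex.norm_real, Real.norm_eq_abs]
  refine isUnit_of_le_norm (.sub (.algebraMap _ (.all t)) hA) hpos
    (le_norm_of_reduces (K := A.ker) hpos.le (fun x hx => ?_) fun x hx => ?_)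
  · rw [happ, show A x = 0 from hx, sub_zero, hn]
    exact ⟨Submodule.smul_mem _ _ hx,
      mul_le_mul_of_nonneg_right (min_le_left _ _) (norm_nonneg _)⟩
  · rw [happ]
    refine ⟨Submodule.sub_mem _ (Submodule.smul_mem _ _ hx) (map_mem_orthogonal_ker hA x), ?_⟩
    have h1 := norm_sub_norm_le (A x) ((t : ℂ) • x)
    rw [norm_sub_rev, hn] at h1
    have h2 := hle x hx
    have h3 := mul_le_mul_of_nonneg_right (min_le_right |t| (c - |t|)) (norm_nonneg x)
    linarith

/-! ### Charts for the spectral flow -/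

/-- A convex set of self-adjoint operators on which the spectral projection of the window `(a, b]`
is continuous of finite rank. -/
structure IsFlowChart (V : Set (H →L[ℂ] H)) (a b : ℝ) : Prop where
  convex : Convex ℝ V
  isSelfAdjoint : ∀ T ∈ V, IsSelfAdjoint T
  continuousOn : ContinuousOn (fun T => specProj T a b) V
  finite : ∀ T ∈ V, FiniteDimensional ℂ (specProj T a b).range
  a_mem : a ∈ Ioo (-1 : ℝ) 0
  b_mem : b ∈ Ioo (0 : ℝ) 1

theorem convex_isSelfAdjoint : Convex ℝ {T : H →L[ℂ] H | IsSelfAdjoint T} :=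
  (selfAdjoint.submodule ℝ (H →L[ℂ] H)).convex

theorem isOpen_disjoint_spectrum_Icc (c d : ℝ) :
    IsOpen {T : H →L[ℂ] H | Disjoint (spectrum ℝ T) (Icc c d)} := by
  rw [isOpen_iff_mem_nhds]
  intro T hT
  have h1 : (Icc c d)ᶜ ∈ 𝓝ˢ (spectrum ℝ T) :=
    isClosed_Icc.isOpen_compl.mem_nhdsSet.2 (Set.subset_compl_iff_disjoint_right.2 hT)
  filter_upwards [(upperHemicontinuous_spectrum ℝ (H →L[ℂ] H)).upperHemicontinuousAt T _ h1]
    with S hS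
  exact Set.subset_compl_iff_disjoint_right.1 (subset_of_mem_nhdsSet hS)

/-- The bands `c/3 ≤ |t| ≤ 2c/3` miss the spectrum of `A`, and still do so for nearby operators.
While they do, the window projection is a continuous function of the operator. -/
theorem exists_isFlowChart {A : H →L[ℂ] H} (hA : IsSelfAdjoint A) (hF : A.IsFredholm) :
    ∃ r > 0, ∃ a b, IsFlowChart ({T | IsSelfAdjoint T} ∩ Metric.ball A r) a b := by
  obtain ⟨hker, c, hc0, hc1, hgap⟩ := exists_spectral_gap hA hF
  have hd1 : Disjoint (spectrum ℝ A) (Icc (-(2 * c / 3)) (-(c / 3))) := by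
    refine Set.disjoint_left.2 fun t ht ⟨h1, h2⟩ => ?_
    have := hgap t ht (abs_lt.2 ⟨by linarith, by linarith⟩)
    linarith
  have hd2 : Disjoint (spectrum ℝ A) (Icc (c / 3) (2 * c / 3)) := by
    refine Set.disjoint_left.2 fun t ht ⟨h1, h2⟩ => ?_
    have := hgap t ht (abs_lt.2 ⟨by linarith, by linarith⟩)
    linarith
  have hlt1 : -(2 * c / 3) < -(c / 3) := by linarith
  have hlt2 : c / 3 < 2 * c / 3 := by linarith
  have hle : -(2 * c / 3) ≤ c / 3 := by linarith
  set V : Set (H →L[ℂ] H) := {T | IsSelfAdjoint T} ∩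
    ({T | Disjoint (spectrum ℝ T) (Icc (-(2 * c / 3)) (-(c / 3)))} ∩
      {T | Disjoint (spectrum ℝ T) (Icc (c / 3) (2 * c / 3))}) with hV
  have hformula : ∀ T ∈ V, specProj T (-(2 * c / 3)) (c / 3) =
      cfc (ramp (c / 3) (2 * c / 3)) T - cfc (ramp (-(2 * c / 3)) (-(c / 3))) T := by
    rintro T ⟨hT, h1, h2⟩
    rw [specProj, specProjIic_eq_cfc hT hlt2 h2, specProjIic_eq_cfc hT hlt1 h1]
  have hcont : ContinuousOn (fun T => specProj T (-(2 * c / 3)) (c / 3)) V := by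
    refine ContinuousOn.congr (ContinuousOn.sub ?_ ?_) hformula
    · exact continuousOn_cfc_of_continuous continuousOn_id (fun T hT => hT.1) (continuous_ramp hlt2)
    · exact continuousOn_cfc_of_continuous continuousOn_id (fun T hT => hT.1) (continuous_ramp hlt1)
  have hAV : A ∈ V := ⟨hA, hd1, hd2⟩
  have hfinA : FiniteDimensional ℂ (specProj A (-(2 * c / 3)) (c / 3)).range := by
    refine Submodule.finiteDimensional_of_le (S₂ := A.ker) ?_
    -- The difference of ramps vanishes at spectral points with `|t| ≥ c`, and the only other
    -- possible spectral point is `0`; so the window of `A` sees only its kernel.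
    have hzero : A * specProj A (-(2 * c / 3)) (c / 3) = 0 := by
      have hc1 := continuous_ramp hlt1
      have hc2 := continuous_ramp hlt2
      rw [hformula A hAV, ← cfc_sub _ _ A (by fun_prop) (by fun_prop)]
      nth_rewrite 1 [← cfc_id' ℝ A]
      rw [← cfc_mul _ _ A (by fun_prop) (by fun_prop), cfc_congr (g := fun _ => 0)]
      · simp
      · intro t ht
        rcases lt_or_ge |t| c with h | h
        · simp [hgap t ht h]
        · rcases le_abs.1 h with h | h
          · simp only [ramp_of_ge hlt1 (show -(c / 3) ≤ t by linarith),
              ramp_of_ge hlt2 (show 2 * c / 3 ≤ t by linarith), sub_self, mul_zero]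
          · simp only [ramp_of_le (show t ≤ -(2 * c / 3) by linarith),
              ramp_of_le (show t ≤ c / 3 by linarith), sub_self, mul_zero]
    rintro _ ⟨x, rfl⟩
    exact congrArg (· x) hzero
  have hnhds : V ∈ 𝓝[{T | IsSelfAdjoint T}] A :=
    Filter.inter_mem self_mem_nhdsWithin (mem_nhdsWithin_of_mem_nhds
      (((isOpen_disjoint_spectrum_Icc _ _).inter (isOpen_disjoint_spectrum_Icc _ _)).mem_nhds
        hAV.2))
  have hclose : ∀ᶠ T in 𝓝[{T | IsSelfAdjoint T}] A, T ∈ V ∧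
      ‖specProj T (-(2 * c / 3)) (c / 3) - specProj A (-(2 * c / 3)) (c / 3)‖ < 1 := by
    have h1 := (hcont A hAV).eventually (Metric.ball_mem_nhds _ one_pos)
    have h2 : 𝓝[V] A = 𝓝[{T | IsSelfAdjoint T}] A :=
      le_antisymm (nhdsWithin_mono _ inter_subset_left)
        (le_inf inf_le_left (le_principal_iff.2 hnhds))
    rw [h2] at h1
    filter_upwards [h1, hnhds] with T hT hTV
    exact ⟨hTV, by simpa [dist_eq_norm] using hT⟩
  obtain ⟨r, hr, hball⟩ := Metric.mem_nhdsWithin_iff.1 hclose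
  have hsub : ∀ T ∈ {T | IsSelfAdjoint T} ∩ Metric.ball A r, T ∈ V ∧
      ‖specProj T (-(2 * c / 3)) (c / 3) - specProj A (-(2 * c / 3)) (c / 3)‖ < 1 :=
    fun T hT => hball ⟨hT.2, hT.1⟩
  refine ⟨r, hr, -(2 * c / 3), c / 3, convex_isSelfAdjoint.inter (convex_ball A r),
    fun T hT => hT.1, hcont.mono fun T hT => (hsub T hT).1, fun T hT => ?_,
    ⟨by linarith, by linarith⟩, ⟨by linarith, by linarith⟩⟩
  exact (finrank_range_le_of_norm_sub_lt_one (isIdempotentElem_specProj T hle) (hsub T hT).2).1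

/-- The nodes of the uniform partition of `[α, β]` into `N` intervals. -/
def node (α β : ℝ) (N k : ℕ) : ℝ := α + k * ((β - α) / N)

theorem node_zero (α β : ℝ) (N : ℕ) : node α β N 0 = α := by simp [node]

theorem node_self (α β : ℝ) {N : ℕ} (hN : 0 < N) : node α β N N = β := by
  have : (N : ℝ) ≠ 0 := by positivity
  rw [node, mul_div_cancel₀ _ this, add_sub_cancel]

theorem node_succ (α β : ℝ) (N k : ℕ) : node α β N (k + 1) = node α β N k + (β - α) / N := by
  simp only [node]; push_cast; ring

theorem strictMono_node {α β : ℝ} (h : α < β) {N : ℕ} (hN : 0 < N) : StrictMono (node α β N) := by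
  have : 0 < (β - α) / N := div_pos (sub_pos.2 h) (by positivity)
  exact strictMono_nat_of_lt_succ fun k => by rw [node_succ]; linarith

theorem Icc_node_subset {α β : ℝ} (h : α < β) {N n : ℕ} (hn : n < N) :
    Icc (node α β N n) (node α β N (n + 1)) ⊆ Icc α β := by
  have hmono := (strictMono_node h (Nat.zero_lt_of_lt hn)).monotone
  refine Icc_subset_Icc ?_ ?_
  · simpa only [node_zero] using hmono (Nat.zero_le n)
  · simpa only [node_self α β (Nat.zero_lt_of_lt hn)] using hmono (Nat.succ_le_of_lt hn)

/-- The charts cover the compact image of `γ`. Half of a Lebesgue number bounds the variation of `γ`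
over one interval, the other half is left for perturbations, so nearby paths share the same charts.
-/
theorem exists_tube {γ : ℝ → H →L[ℂ] H} {α β : ℝ} (h : α < β) (hγ : ContinuousOn γ (Icc α β))
    (hsa : ∀ s ∈ Icc α β, IsSelfAdjoint (γ s)) (hF : ∀ s ∈ Icc α β, (γ s).IsFredholm) :
    ∃ ε > 0, ∃ N : ℕ, 0 < N ∧ ∃ (V : ℕ → Set (H →L[ℂ] H)) (a b : ℕ → ℝ),
      ∀ n < N, IsFlowChart (V n) (a n) (b n) ∧
        ∀ s ∈ Icc (node α β N n) (node α β N (n + 1)), ∀ T, IsSelfAdjoint T →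
          ‖T - γ s‖ < ε → T ∈ V n := by
  have hchart : ∀ A : {A : H →L[ℂ] H // IsSelfAdjoint A ∧ A.IsFredholm}, ∃ r > 0, ∃ a b,
      IsFlowChart ({T | IsSelfAdjoint T} ∩ Metric.ball A.1 r) a b :=
    fun A => exists_isFlowChart A.2.1 A.2.2
  choose r hr a b hab using hchart
  obtain ⟨δ, hδ, hleb⟩ := lebesgue_number_lemma_of_metric (isCompact_Icc.image_of_continuousOn hγ)
    (c := fun A => Metric.ball A.1 (r A)) (fun A => Metric.isOpen_ball) (by
      rintro _ ⟨s, hs, rfl⟩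
      exact mem_iUnion.2 ⟨⟨γ s, hsa s hs, hF s hs⟩, Metric.mem_ball_self (hr _)⟩)
  obtain ⟨η, hη, huc⟩ := Metric.uniformContinuousOn_iff.1
    (isCompact_Icc.uniformContinuousOn_of_continuous hγ) (δ / 2) (half_pos hδ)
  obtain ⟨N, hN⟩ := exists_nat_gt ((β - α) / η)
  have hN0 : 0 < N := by
    have : (0 : ℝ) < N := (div_pos (sub_pos.2 h) hη).trans hN
    exact_mod_cast this
  have hstep : (β - α) / N < η := by
    rw [div_lt_iff₀ hη] at hN
    rw [div_lt_iff₀ (by positivity)]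
    linarith
  have hmain : ∀ n, n < N → ∃ (V : Set (H →L[ℂ] H)) (a b : ℝ), IsFlowChart V a b ∧
      ∀ s ∈ Icc (node α β N n) (node α β N (n + 1)), ∀ T, IsSelfAdjoint T →
          ‖T - γ s‖ < δ / 2 → T ∈ V := by
    intro n hn
    have hlt := strictMono_node h hN0 (Nat.lt_succ_self n)
    have hmem : node α β N n ∈ Icc α β := Icc_node_subset h hn (left_mem_Icc.2 hlt.le)
    obtain ⟨A, hA⟩ := hleb _ (mem_image_of_mem γ hmem)
    refine ⟨_, _, _, hab A, fun s hs T hT hTs => ⟨hT, hA ?_⟩⟩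
    have hd := huc s (Icc_node_subset h hn hs) _ hmem (by
      rw [Real.dist_eq, abs_of_nonneg (by linarith [hs.1])]
      have := hs.2
      rw [node_succ] at this
      linarith)
    rw [Metric.mem_ball]
    rw [← dist_eq_norm] at hTs
    linarith [dist_triangle T (γ s) (γ (node α β N n))]
  choose! V a b hV using hmain
  exact ⟨δ / 2, half_pos hδ, N, hN0, V, a, b, hV⟩

theorem exists_flowPartition {γ : ℝ → H →L[ℂ] H} {α β : ℝ} (h : α < β)
    (hγ : ContinuousOn γ (Icc α β)) {N : ℕ} (hN : 0 < N) {V : ℕ → Set (H →L[ℂ] H)} {a b : ℕ → ℝ}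
    (hV : ∀ n < N, IsFlowChart (V n) (a n) (b n))
    (hmem : ∀ n < N, ∀ s ∈ Icc (node α β N n) (node α β N (n + 1)), γ s ∈ V n) :
    ∃ P : FlowPartition γ α β, P.value = ∑ n ∈ Finset.range N,
      ((specRank (γ (node α β N n)) (a n) 0 : ℤ) -
        specRank (γ (node α β N (n + 1))) (a n) 0) := by
  have hcont : ∀ n < N, ContinuousOn (fun t => specProj (γ t) (a n) (b n))
      (Icc (node α β N n) (node α β N (n + 1))) := fun n hn =>
    (hV n hn).continuousOn.comp (hγ.mono (Icc_node_subset h hn)) (hmem n hn)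
  let P : FlowPartition γ α β :=
    { N := N
      s := fun k => node α β N k
      a := fun n => a n
      b := fun n => b n
      s_mono := (strictMono_node h hN).comp Fin.val_strictMono
      s_first := node_zero α β N
      s_last := node_self α β hN
      a_mem := fun n => (hV n n.2).a_mem
      b_mem := fun n => (hV n n.2).b_mem
      continuousOn := fun n => hcont n n.2
      finite_rank := fun n t ht => (hV n n.2).finite _ (hmem n n.2 t ht)
      const_rank := fun n => ⟨_, fun t ht => finrank_range_eq_of_isPreconnected isPreconnected_Icc
        (hcont n n.2) (fun s _ => isIdempotentElem_specProj _
          ((hV n n.2).a_mem.2.trans (hV n n.2).b_mem.1).le)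
        (fun s hs => (hV n n.2).finite _ (hmem n n.2 s hs)) ht
        (left_mem_Icc.2 (strictMono_node h hN (Nat.lt_succ_self n)).le)⟩ }
  refine ⟨P, ?_⟩
  exact Fin.sum_univ_eq_sum_range (fun n => ((specRank (γ (node α β N n)) (a n) 0 : ℤ) -
        specRank (γ (node α β N (n + 1))) (a n) 0)) N

/-- Here `D n k` stands for the difference of the counts of two paths at node `k` in window `n`. It
agrees for the two windows meeting at an interior node, so the sum telescopes. -/
theorem sum_diagonal_sub (D : ℕ → ℕ → ℤ) (N : ℕ)
    (hD : ∀ n < N, D n (n + 1) = D (n + 1) (n + 1)) :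
    ∑ n ∈ Finset.range (N + 1), (D n n - D n (n + 1)) = D 0 0 - D N (N + 1) := by
  induction N with
  | zero => simp
  | succ N ih =>
    rw [Finset.sum_range_succ, ih fun n hn => hD n (by lia), hD N (Nat.lt_succ_self N)]
    ring

/-- Stability of the spectral flow: nearby paths have spectral flows which differ only by the
changes of the number of nonpositive eigenvalues at the end points. -/
theorem exists_flowPartition_sub {γ : ℝ → H →L[ℂ] H} {α β : ℝ} (h : α < β)
    (hγ : ContinuousOn γ (Icc α β)) (hsa : ∀ s ∈ Icc α β, IsSelfAdjoint (γ s))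
    (hF : ∀ s ∈ Icc α β, (γ s).IsFredholm) :
    ∃ ε > 0, ∀ γ' : ℝ → H →L[ℂ] H, ContinuousOn γ' (Icc α β) →
      (∀ s ∈ Icc α β, IsSelfAdjoint (γ' s)) → (∀ s ∈ Icc α β, ‖γ' s - γ s‖ < ε) →
      ∃ (P : FlowPartition γ α β) (P' : FlowPartition γ' α β) (a a' : ℝ),
        P.value - P'.value =
          ((specRank (γ α) a 0 : ℤ) - specRank (γ' α) a 0) -
            (specRank (γ β) a' 0 - specRank (γ' β) a' 0) := by
  obtain ⟨ε, hε, N, hN, V, a, b, hV⟩ := exists_tube h hγ hsa hF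
  refine ⟨ε, hε, fun γ' hγ' hsa' hclose => ?_⟩
  have hmem : ∀ n < N, ∀ s ∈ Icc (node α β N n) (node α β N (n + 1)), γ s ∈ V n :=
    fun n hn s hs => (hV n hn).2 s hs _ (hsa s (Icc_node_subset h hn hs)) (by simpa using hε)
  have hmem' : ∀ n < N, ∀ s ∈ Icc (node α β N n) (node α β N (n + 1)), γ' s ∈ V n :=
    fun n hn s hs => (hV n hn).2 s hs _ (hsa' s (Icc_node_subset h hn hs))
      (hclose s (Icc_node_subset h hn hs))
  obtain ⟨P, hP⟩ := exists_flowPartition h hγ hN (fun n hn => (hV n hn).1) hmem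
  obtain ⟨P', hP'⟩ := exists_flowPartition h hγ' hN (fun n hn => (hV n hn).1) hmem'
  obtain ⟨M, rfl⟩ := Nat.exists_eq_succ_of_ne_zero hN.ne'
  refine ⟨P, P', a 0, a M, ?_⟩
  have hmono := (strictMono_node h hN)
  have hkey := sum_diagonal_sub (fun n k => (specRank (γ (node α β (M + 1) k)) (a n) 0 : ℤ) -
    specRank (γ' (node α β (M + 1) k)) (a n) 0) M fun n hn => by
      have hn1 : n < M + 1 := by lia
      have hn2 : n + 1 < M + 1 := by lia
      have hr := right_mem_Icc.2 (hmono (Nat.lt_succ_self n)).le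
      have hl := left_mem_Icc.2 (hmono (Nat.lt_succ_self (n + 1))).le
      have c1 := (hV n hn1).1
      have c2 := (hV (n + 1) hn2).1
      -- The connected family is the intersection of consecutive charts itself. It is convex and
      -- contains both paths' values at the common node.
      have := specRank_sub_specRank_eq (S := V n ∩ V (n + 1)) (T := id)
        (c1.convex.inter c2.convex).isPreconnected continuousOn_id
        (fun T hT => c1.isSelfAdjoint T hT.1) c1.a_mem.2 c1.b_mem.1 c2.a_mem.2 c2.b_mem.1
        (c1.continuousOn.mono inter_subset_left) (c2.continuousOn.mono inter_subset_right)
        (fun T hT => c1.finite T hT.1) (fun T hT => c2.finite T hT.2)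
        ⟨hmem n hn1 _ hr, hmem (n + 1) hn2 _ hl⟩ ⟨hmem' n hn1 _ hr, hmem' (n + 1) hn2 _ hl⟩
      simp only [id] at this
      linarith
  rw [node_zero, node_self α β hN] at hkey
  rw [hP, hP', ← Finset.sum_sub_distrib, ← hkey]
  exact Finset.sum_congr rfl fun n _ => by ring

/-! ### Kramers degeneracy -/

/-- A finite-dimensional complex space with a quaternionic structure has even dimension. -/
theorem even_finrank_of_antilinear {E : Type*} [AddCommGroup E] [Module ℂ E]
    [FiniteDimensional ℂ E] (J : E →ₗ⋆[ℂ] E) (hJ : ∀ x, J (J x) = -x) :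
    Even (Module.finrank ℂ E) := by
  let b := Module.finBasis ℂ E
  -- The matrix of `J` satisfies `A * conj A = -1`, so `|det A|² = (-1) ^ n` with `n` the dimension,
  -- which forces `n` to be even.
  let A : Matrix (Fin (Module.finrank ℂ E)) (Fin (Module.finrank ℂ E)) ℂ :=
    fun i j => b.repr (J (b j)) i
  have hA : A * A.map (starRingEnd ℂ) = -1 := by
    ext i k
    have h1 : J (J (b k)) = ∑ j, starRingEnd ℂ (A j k) • J (b j) := by
      conv_lhs => rw [← b.sum_repr (J (b k)), map_sum]
      exact Finset.sum_congr rfl fun j _ => J.map_smulₛₗ _ _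
    have h2 := congrArg (fun x => b.repr x i) h1
    simp only [hJ, map_neg, map_sum, map_smul, Finsupp.coe_neg, Pi.neg_apply, Module.Basis.repr_self,
      Finsupp.coe_finsetSum, Finset.sum_apply, Finsupp.coe_smul, Pi.smul_apply, smul_eq_mul] at h2
    rw [Matrix.mul_apply, Matrix.neg_apply, Matrix.one_apply]
    rw [Finsupp.single_apply] at h2
    simp only [Matrix.map_apply, eq_comm (a := i), h2]
    exact Finset.sum_congr rfl fun j _ => mul_comm _ _
  have hdet := congrArg Matrix.det hA
  rw [Matrix.det_mul, ← RingHom.mapMatrix_apply, ← RingHom.map_det, Matrix.det_neg, Matrix.det_one,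
    mul_one, Fintype.card_fin, Complex.mul_conj] at hdet
  by_contra hodd
  rw [(Nat.not_even_iff_odd.1 hodd).neg_one_pow] at hdet
  have : Complex.normSq A.det = -1 := by exact_mod_cast hdet
  linarith [Complex.normSq_nonneg A.det]

omit [CompleteSpace H] in
-- Polarization: antilinearity exchanges the two terms with `±i`.
theorem inner_antiunitary (C : H ≃ₗᵢ⋆[ℂ] H) (x y : H) :
    inner ℂ (C x) (C y) = starRingEnd ℂ (inner ℂ x y) := by
  have h : ∀ s : ℂ, ‖C x + s • C y‖ = ‖x + starRingEnd ℂ s • y‖ := fun s => by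
    rw [← C.norm_map (x + _), map_add, C.map_smulₛₗ, Complex.conj_conj]
  have h1 := h 1
  have h2 := h (-1)
  have h3 := h Complex.I
  have h4 := h (-Complex.I)
  simp only [one_smul, neg_smul, map_one, map_neg, Complex.conj_I, neg_neg, ← sub_eq_add_neg]
    at h1 h2 h3 h4
  rw [inner_eq_sum_norm_sq_div_four, inner_eq_sum_norm_sq_div_four x y]
  simp only [RCLike.I_to_complex, Complex.coe_algebraMap, h1, h2, h3, h4, map_div₀, map_add,
    map_sub, map_mul, map_pow, Complex.conj_ofReal, Complex.conj_I, map_ofNat]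
  ring

omit [CompleteSpace H] in
theorem conjOp_apply (C : H ≃ₗᵢ⋆[ℂ] H) (T : H →L[ℂ] H) (x : H) : conjOp C T x = C (T (C x)) := rfl

section Involution

variable {C : H ≃ₗᵢ⋆[ℂ] H} (hC : ∀ x, C (C x) = x)

omit [CompleteSpace H] in
include hC in
theorem conjOp_one : conjOp C 1 = 1 := by
  ext x; simp [conjOp_apply, hC]

omit [CompleteSpace H] in
include hC in
theorem conjOp_mul (S T : H →L[ℂ] H) : conjOp C (S * T) = conjOp C S * conjOp C T := by
  ext x; simp [conjOp_apply, hC]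

omit [CompleteSpace H] in
theorem conjOp_add (S T : H →L[ℂ] H) : conjOp C (S + T) = conjOp C S + conjOp C T := by
  ext x; simp [conjOp_apply]

omit [CompleteSpace H] in
include hC in
theorem conjOp_smul_one (r : ℝ) : conjOp C ((r : ℂ) • 1) = (r : ℂ) • 1 := by
  ext x
  change C ((r : ℂ) • C x) = (r : ℂ) • x
  rw [C.map_smulₛₗ, Complex.conj_ofReal, hC]

omit [CompleteSpace H] in
theorem norm_conjOp_le (T : H →L[ℂ] H) : ‖conjOp C T‖ ≤ ‖T‖ :=
  ContinuousLinearMap.opNorm_le_bound _ (norm_nonneg _) fun x => by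
    rw [conjOp_apply, C.norm_map]
    simpa using T.le_opNorm (C x)

include hC in
theorem conjOp_star (T : H →L[ℂ] H) : conjOp C (star T) = star (conjOp C T) := by
  have key : ∀ x y, inner ℂ (C x) y = starRingEnd ℂ (inner ℂ x (C y)) := fun x y => by
    rw [← inner_antiunitary C, hC]
  ext x
  refine ext_inner_right ℂ fun y => ?_
  rw [ContinuousLinearMap.star_eq_adjoint (conjOp C T), ContinuousLinearMap.adjoint_inner_left,
    conjOp_apply, conjOp_apply, key, ContinuousLinearMap.star_eq_adjoint,
    ContinuousLinearMap.adjoint_inner_left, key, Complex.conj_conj]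

/-- Conjugation by the anti-unitary operator `C W` as a real homomorphism of star algebras. -/
def antiConj (C : H ≃ₗᵢ⋆[ℂ] H) (hC : ∀ x, C (C x) = x) (W : H →L[ℂ] H)
    (hW : W ∈ unitary (H →L[ℂ] H)) : (H →L[ℂ] H) →⋆ₐ[ℝ] (H →L[ℂ] H) where
  toFun T := star W * conjOp C T * W
  map_one' := by rw [conjOp_one hC, mul_one, Unitary.star_mul_self_of_mem hW]
  map_mul' S T := by
    calc star W * conjOp C (S * T) * W
        = star W * conjOp C S * (1 * (conjOp C T * W)) := by rw [conjOp_mul hC]; noncomm_ring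
      _ = _ := by rw [← Unitary.mul_star_self_of_mem hW]; noncomm_ring
  map_zero' := by
    have : conjOp C (0 : H →L[ℂ] H) = 0 := by ext x; simp [conjOp_apply]
    rw [this, mul_zero, zero_mul]
  map_add' S T := by rw [conjOp_add, mul_add, add_mul]
  commutes' r := by
    have : (algebraMap ℝ (H →L[ℂ] H)) r = (r : ℂ) • 1 := by
      rw [Algebra.algebraMap_eq_smul_one]; rfl
    rw [this, conjOp_smul_one hC, mul_smul_comm, smul_mul_assoc, mul_one,
      Unitary.star_mul_self_of_mem hW]
  map_star' T := by rw [conjOp_star hC, star_mul, star_mul, star_star, mul_assoc]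

theorem continuous_antiConj {W : H →L[ℂ] H} (hW : W ∈ unitary (H →L[ℂ] H)) :
    Continuous (antiConj C hC W hW) := by
  refine AddMonoidHomClass.continuous_of_bound (antiConj C hC W hW) (‖star W‖ * ‖W‖) fun T => ?_
  change ‖star W * conjOp C T * W‖ ≤ _
  calc ‖star W * conjOp C T * W‖ ≤ ‖star W‖ * ‖conjOp C T‖ * ‖W‖ :=
        (norm_mul_le _ _).trans (mul_le_mul_of_nonneg_right (norm_mul_le _ _) (norm_nonneg _))
    _ ≤ ‖star W‖ * ‖T‖ * ‖W‖ := by gcongr; exact norm_conjOp_le T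
    _ = _ := by ring

end Involution

/-- `T` commutes with the anti-unitary operator `C W`, whose square is `-1`. -/
structure IsKramers (C : H ≃ₗᵢ⋆[ℂ] H) (W T : H →L[ℂ] H) : Prop where
  conj_conj : ∀ x, C (C x) = x
  mem_unitary : W ∈ unitary (H →L[ℂ] H)
  conjOp_mul_self : conjOp C W * W = -1
  conj_eq : star W * conjOp C T * W = T

namespace IsKramers

variable {C : H ≃ₗᵢ⋆[ℂ] H} {W T : H →L[ℂ] H}

theorem sq_apply (h : IsKramers C W T) (x : H) : C (W (C (W x))) = -x := by
  have := congrArg (· x) h.conjOp_mul_self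
  simpa [conjOp_apply] using this

theorem comm_apply (h : IsKramers C W T) (x : H) : T (C (W x)) = C (W (T x)) := by
  have h1 : conjOp C T * W = W * T := by
    conv_rhs => rw [← h.conj_eq]
    rw [← mul_assoc, ← mul_assoc, Unitary.mul_star_self_of_mem h.mem_unitary, one_mul]
  have := congrArg (· x) h1
  simp only [mul_apply_eq_comp, conjOp_apply] at this
  rw [← this, h.conj_conj]

theorem inner_apply (h : IsKramers C W T) (x y : H) :
    inner ℂ (C (W x)) (C (W y)) = starRingEnd ℂ (inner ℂ x y) := by
  rw [inner_antiunitary, ContinuousLinearMap.inner_map_map_of_mem_unitary h.mem_unitary]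

/-- The map `antiConj` is a continuous real star-algebra homomorphism fixing `T`, hence commutes
with the real functional calculus. -/
theorem cfc (h : IsKramers C W T) (hT : IsSelfAdjoint T) {f : ℝ → ℝ} (hf : Continuous f) :
    IsKramers C W (cfc f T) := by
  refine ⟨h.conj_conj, h.mem_unitary, h.conjOp_mul_self, ?_⟩
  have heq : antiConj C h.conj_conj W h.mem_unitary T = T := h.conj_eq
  have := StarAlgHom.map_cfc (antiConj C h.conj_conj W h.mem_unitary) f T hf.continuousOn
    (continuous_antiConj h.conj_conj h.mem_unitary) hT (by rw [heq]; exact hT)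
  rw [heq] at this
  exact this

theorem mem_specSubspace (h : IsKramers C W T) (hT : IsSelfAdjoint T) {c : ℝ} {x : H}
    (hx : x ∈ specSubspace T c) : C (W x) ∈ specSubspace T c := by
  rw [ZTwoFlow.mem_specSubspace] at hx ⊢
  rw [(h.cfc hT (f := fun x : ℝ => max (x - c) 0) (by fun_prop)).comm_apply, hx, map_zero, map_zero]

/-- The anti-unitary `C W` preserves the subspace and, as its square is `-1`, also the orthogonal
complement. -/
theorem specProjIic_apply (h : IsKramers C W T) (hT : IsSelfAdjoint T) (c : ℝ) (x : H) :
    specProjIic T c (C (W x)) = C (W (specProjIic T c x)) := by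
  rw [specProjIic_eq]
  refine Submodule.eq_starProjection_of_mem_orthogonal
    (h.mem_specSubspace hT (Submodule.starProjection_apply_mem _ _)) ?_
  rw [← map_sub, ← map_sub, Submodule.mem_orthogonal]
  intro y hy
  have h1 : y = -C (W (C (W y))) := by rw [h.sq_apply, neg_neg]
  rw [h1, inner_neg_left, h.inner_apply, Submodule.inner_right_of_mem_orthogonal
    (h.mem_specSubspace hT hy) (Submodule.sub_starProjection_mem_orthogonal x), map_zero, neg_zero]

theorem specProj_apply (h : IsKramers C W T) (hT : IsSelfAdjoint T) (a b : ℝ) (x : H) :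
    specProj T a b (C (W x)) = C (W (specProj T a b x)) := by
  rw [specProj, sub_apply, sub_apply, h.specProjIic_apply hT, h.specProjIic_apply hT, map_sub,
    map_sub]

/-- Kramers degeneracy: spectral multiplicities are even. -/
theorem even_specRank (h : IsKramers C W T) (hT : IsSelfAdjoint T) (a b : ℝ) :
    Even (specRank T a b) := by
  by_cases hfin : FiniteDimensional ℂ (specProj T a b).range
  · refine even_finrank_of_antilinear (E := (specProj T a b).range)
      { toFun := fun x => ⟨C (W x), by
          obtain ⟨_, y, rfl⟩ := x
          exact ⟨C (W y), h.specProj_apply hT a b y⟩⟩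
        map_add' := fun x y => Subtype.ext (by simp)
        map_smul' := fun s x => Subtype.ext (by simp [C.map_smulₛₗ]) } fun x => Subtype.ext ?_
    exact h.sq_apply x
  -- An infinite rank is recorded as `0`, which is even.
  · rw [specRank, Module.finrank_of_not_finite hfin]
    exact Even.zero

end IsKramers

/-- The adjoint form of odd symmetry. It gives `(C I U)² = -1` and the reflection of the line path.
-/
theorem IsOddSymmetric.star_mul_conjOp_mul {C : H ≃ₗᵢ⋆[ℂ] H} {I U : H →L[ℂ] H}
    (hodd : IsOddSymmetric C I U) : star I * conjOp C U * I = star U := by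
  have := congrArg star hodd
  rwa [star_mul, star_mul, transposeOp, star_star, star_star, ← mul_assoc] at this

namespace IsQuaternionicData

variable {C : H ≃ₗᵢ⋆[ℂ] H} {I : H →L[ℂ] H}

theorem star_eq (hI : IsQuaternionicData C I) : star I = -I := by
  have h1 : star I * (I * I) = I := by
    rw [← mul_assoc, Unitary.star_mul_self_of_mem hI.mem_unitary, one_mul]
  rw [hI.sq, mul_neg, mul_one] at h1
  exact neg_eq_iff_eq_neg.1 h1

theorem conj_eq (hI : IsQuaternionicData C I) {F : H →L[ℂ] H} (hF : IsSelfAdjoint F)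
    (hodd : IsOddSymmetric C I F) : star I * conjOp C F * I = F := by
  rwa [IsOddSymmetric, transposeOp, ← conjOp_star hI.conj_conj, hF.star_eq] at hodd

theorem isKramers (hI : IsQuaternionicData C I) {F : H →L[ℂ] H} (hF : IsSelfAdjoint F)
    (hodd : IsOddSymmetric C I F) : IsKramers C I F :=
  ⟨hI.conj_conj, hI.mem_unitary, by rw [hI.real, hI.sq], hI.conj_eq hF hodd⟩

theorem isKramers_mul (hI : IsQuaternionicData C I) {U F : H →L[ℂ] H}
    (hU : U ∈ unitary (H →L[ℂ] H)) (hodd : IsOddSymmetric C I U) (hF : IsSelfAdjoint F)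
    (hsymm : F = star (I * U) * transposeOp C F * (I * U)) : IsKramers C (I * U) F := by
  refine ⟨hI.conj_conj, mul_mem hI.mem_unitary hU, ?_, ?_⟩
  · have h := hodd.star_mul_conjOp_mul
    rw [hI.star_eq] at h
    calc conjOp C (I * U) * (I * U) = -(-I * conjOp C U * I) * U := by
          rw [conjOp_mul hI.conj_conj, hI.real]; noncomm_ring
      _ = -1 := by rw [h, neg_mul, Unitary.star_mul_self_of_mem hU]
  · rw [transposeOp, ← conjOp_star hI.conj_conj, hF.star_eq] at hsymm
    exact hsymm.symm

end IsQuaternionicData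

/-! ### The spectral flow modulo two -/

/-- `antiConj` is linear over the reals, so its fixed points are closed under real affine
combinations. -/
theorem IsKramers.add_smul_sub {C : H ≃ₗᵢ⋆[ℂ] H} {W S T : H →L[ℂ] H} (hS : IsKramers C W S)
    (hT : IsKramers C W T) (t : ℝ) : IsKramers C W (S + t • (T - S)) := by
  refine ⟨hS.conj_conj, hS.mem_unitary, hS.conjOp_mul_self, ?_⟩
  have eS : antiConj C hS.conj_conj W hS.mem_unitary S = S := hS.conj_eq
  have eT : antiConj C hS.conj_conj W hS.mem_unitary T = T := hT.conj_eq
  have : antiConj C hS.conj_conj W hS.mem_unitary (S + t • (T - S)) = S + t • (T - S) := by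
    rw [map_add, map_smul, map_sub, eS, eT]
  exact this

theorem isSelfAdjoint_add_smul_sub {S T : H →L[ℂ] H} (hS : IsSelfAdjoint S)
    (hT : IsSelfAdjoint T) (t : ℝ) : IsSelfAdjoint (S + t • (T - S)) :=
  hS.add ((IsSelfAdjoint.all t).smul (hT.sub hS))

section ModTwo

variable {α β : ℝ}

theorem nonempty_flowPartition {γ : ℝ → H →L[ℂ] H} (h : α < β) (hγ : ContinuousOn γ (Icc α β))
    (hsa : ∀ s ∈ Icc α β, IsSelfAdjoint (γ s)) (hF : ∀ s ∈ Icc α β, (γ s).IsFredholm) :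
    Nonempty (FlowPartition γ α β) := by
  obtain ⟨ε, hε, hP⟩ := exists_flowPartition_sub h hγ hsa hF
  obtain ⟨P, -⟩ := hP γ hγ hsa fun s _ => by simpa using hε
  exact ⟨P⟩

/-- If all spectral multiplicities at the end points are even, then the parity of the spectral flow
is stable under small perturbations of the path. -/
theorem exists_spectralFlow_cast_eq {γ : ℝ → H →L[ℂ] H} (h : α < β)
    (hγ : ContinuousOn γ (Icc α β)) (hsa : ∀ s ∈ Icc α β, IsSelfAdjoint (γ s))
    (hF : ∀ s ∈ Icc α β, (γ s).IsFredholm) (hα : ∀ a b, Even (specRank (γ α) a b))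
    (hβ : ∀ a b, Even (specRank (γ β) a b)) :
    ∃ ε > 0, ∀ γ' : ℝ → H →L[ℂ] H, ContinuousOn γ' (Icc α β) →
      (∀ s ∈ Icc α β, IsSelfAdjoint (γ' s)) → (∀ s ∈ Icc α β, ‖γ' s - γ s‖ < ε) →
      (∀ a b, Even (specRank (γ' α) a b)) → (∀ a b, Even (specRank (γ' β) a b)) →
      (spectralFlow γ' α β : ZMod 2) = spectralFlow γ α β := by
  obtain ⟨ε, hε, hP⟩ := exists_flowPartition_sub h hγ hsa hF
  refine ⟨ε, hε, fun γ' hγ' hsa' hclose hα' hβ' => ?_⟩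
  obtain ⟨P, P', a, a', hval⟩ := hP γ' hγ' hsa' hclose
  have e : ∀ {n : ℕ}, Even n → Even (n : ℤ) := fun hn => (Int.even_coe_nat _).2 hn
  rw [P.spectralFlow_eq hγ hsa, P'.spectralFlow_eq hγ' hsa', eq_comm, ← sub_eq_zero,
    ← Int.cast_sub, hval]
  refine (ZMod.intCast_zmod_eq_zero_iff_dvd _ 2).2 (even_iff_two_dvd.1 ?_)
  exact ((e (hα a 0)).sub (e (hα' a 0))).sub ((e (hβ a' 0)).sub (e (hβ' a' 0)))

/-- The parity of the spectral flow is invariant under linear homotopies through paths of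
self-adjoint Fredholm operators with even multiplicities at the end points. -/
theorem spectralFlow_cast_eq_of_homotopy {γ₀ γ₁ : ℝ → H →L[ℂ] H} (h : α < β)
    (hγ₀ : ContinuousOn γ₀ (Icc α β)) (hγ₁ : ContinuousOn γ₁ (Icc α β))
    (hsa₀ : ∀ s ∈ Icc α β, IsSelfAdjoint (γ₀ s)) (hsa₁ : ∀ s ∈ Icc α β, IsSelfAdjoint (γ₁ s))
    (hF : ∀ t : ℝ, ∀ s ∈ Icc α β, (γ₀ s + t • (γ₁ s - γ₀ s)).IsFredholm)
    (hα : ∀ t : ℝ, ∀ a b, Even (specRank (γ₀ α + t • (γ₁ α - γ₀ α)) a b))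
    (hβ : ∀ t : ℝ, ∀ a b, Even (specRank (γ₀ β + t • (γ₁ β - γ₀ β)) a b)) :
    (spectralFlow γ₁ α β : ZMod 2) = spectralFlow γ₀ α β := by
  set g : ℝ → ℝ → H →L[ℂ] H := fun t s => γ₀ s + t • (γ₁ s - γ₀ s) with hg
  have hcont : ∀ t, ContinuousOn (g t) (Icc α β) := fun t =>
    hγ₀.add ((hγ₁.sub hγ₀).const_smul t)
  have hsa : ∀ t, ∀ s ∈ Icc α β, IsSelfAdjoint (g t s) := fun t s hs =>
    isSelfAdjoint_add_smul_sub (hsa₀ s hs) (hsa₁ s hs) t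
  obtain ⟨M, hM⟩ := isCompact_Icc.exists_bound_of_continuousOn (hγ₁.sub hγ₀)
  have hM0 : 0 ≤ M := (norm_nonneg _).trans (hM α (left_mem_Icc.2 h.le))
  -- The hypotheses hold for every real `t`, so the homotopy parameter runs over the connected line.
  -- The `+ 1` in the radius below covers `M = 0`.
  have hloc : IsLocallyConstant fun t : ℝ => (spectralFlow (g t) α β : ZMod 2) := by
    rw [IsLocallyConstant.iff_eventually_eq]
    intro t
    obtain ⟨ε, hε, hst⟩ := exists_spectralFlow_cast_eq h (hcont t) (hsa t) (hF t) (hα t) (hβ t)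
    filter_upwards [Metric.ball_mem_nhds t (show 0 < ε / (M + 1) by positivity)] with u hu
    refine hst (g u) (hcont u) (hsa u) (fun s hs => ?_) (hα u) (hβ u)
    have h1 : g u s - g t s = (u - t) • (γ₁ s - γ₀ s) := by
      simp only [hg, sub_smul]; abel
    rw [Metric.mem_ball, Real.dist_eq, lt_div_iff₀ (by positivity)] at hu
    rw [h1, norm_smul, Real.norm_eq_abs]
    calc |u - t| * ‖γ₁ s - γ₀ s‖ ≤ |u - t| * (M + 1) := by
          gcongr
          exact (hM s hs).trans (by linarith)
      _ < ε := hu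
  have h1 : g 1 = γ₁ := by funext s; simp [hg]
  have h0 : g 0 = γ₀ := by funext s; simp [hg]
  have := hloc.apply_eq_of_preconnectedSpace 1 0
  simp only [h1, h0] at this
  exact this

end ModTwo

/-! ### The `ℤ/2`-valued spectral flow of a pair -/

/-- An upper bound on the norm suffices: the preserved essential spectrum puts `1` in the spectrum,
which forces norm at least `1`. -/
theorem mem_SFhat_of_compact {F K : H →L[ℂ] H} (hF : F ∈ SFhat H) (hK : IsSelfAdjoint K)
    (hc : IsCompactOperator K) (hn : ‖F + K‖ ≤ 1) : F + K ∈ SFhat H := by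
  obtain ⟨⟨⟨hFred, hsa⟩, -, -⟩, -, hess⟩ := hF
  have hess' : essSpectrum (F + K) = {-1, 1} := by rw [essSpectrum_add_compact hsa hK hc, hess]
  refine ⟨⟨⟨isFredholm_add_compact hsa hFred hK hc, hsa.add hK⟩, ⟨1, one_pos, ?_⟩,
    ⟨-1, by norm_num, ?_⟩⟩, le_antisymm hn ?_, hess'⟩
  · simp [hess']
  · simp [hess']
  · have h1 : (1 : ℂ) ∈ spectrum ℂ (F + K) := essSpectrum_subset_spectrum _ (by simp [hess'])
    have h2 := spectrum.norm_le_norm_mul_of_mem h1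
    rw [norm_one] at h2
    exact h2.trans (mul_le_of_le_one_right (norm_nonneg _) ContinuousLinearMap.norm_id_le)

section Pair

variable {C : H ≃ₗᵢ⋆[ℂ] H} {I F U : H →L[ℂ] H}

theorem star_mul_commutator (hU : U ∈ unitary (H →L[ℂ] H)) :
    star U * (F * U - U * F) = star U * F * U - F := by
  rw [mul_sub, ← mul_assoc, ← mul_assoc, Unitary.star_mul_self_of_mem hU, one_mul]

theorem isSelfAdjoint_star_mul_mul (hF : IsSelfAdjoint F) : IsSelfAdjoint (star U * F * U) := by
  rw [IsSelfAdjoint, star_mul, star_mul, star_star, hF.star_eq, mul_assoc]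

/-- In this form the path is the straight segment from `F` to `U* F U`, so self-adjointness and the
norm bound follow from its end points. -/
theorem linePath_eq (hU : U ∈ unitary (H →L[ℂ] H)) (s : ℝ) :
    linePath F U s = F + s • (star U * F * U - F) := by
  rw [linePath, star_mul_commutator hU, Complex.coe_smul]

theorem isSelfAdjoint_linePath (hF : IsSelfAdjoint F) (hU : U ∈ unitary (H →L[ℂ] H)) (s : ℝ) :
    IsSelfAdjoint (linePath F U s) := by
  rw [linePath_eq hU]
  exact isSelfAdjoint_add_smul_sub hF (isSelfAdjoint_star_mul_mul hF) s

theorem continuous_linePath (F U : H →L[ℂ] H) : Continuous (linePath F U) := by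
  unfold linePath
  fun_prop

theorem norm_linePath_le (hn : ‖F‖ = 1) (hU : U ∈ unitary (H →L[ℂ] H)) {s : ℝ}
    (hs : s ∈ Icc (0 : ℝ) 1) : ‖linePath F U s‖ ≤ 1 := by
  have h1 : ‖star U * F * U‖ = 1 := by
    rw [CStarRing.norm_mul_mem_unitary _ hU, CStarRing.norm_mem_unitary_mul _ (Unitary.star_mem hU), hn]
  have h2 : linePath F U s = (1 - s) • F + s • (star U * F * U) := by
    rw [linePath_eq hU]; module
  rw [h2]
  refine (norm_add_le _ _).trans ?_
  rw [norm_smul, norm_smul, h1, hn, Real.norm_of_nonneg hs.1, Real.norm_of_nonneg (by linarith [hs.2])]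
  linarith

/-- Conjugation `θ` by `C I` fixes `F` and sends `U` to `U*`, so it carries the segment to the one
from `F` to `U F U*`. Conjugating with `U` turns this into the segment from `U* F U` to `F`, the
original one reversed. -/
theorem linePath_symm (hI : IsQuaternionicData C I) (hF : IsSelfAdjoint F)
    (hFodd : IsOddSymmetric C I F) (hU : U ∈ unitary (H →L[ℂ] H)) (hUodd : IsOddSymmetric C I U)
    (s : ℝ) :
    linePath F U (1 - s) = star (I * U) * transposeOp C (linePath F U s) * (I * U) := by
  set θ := antiConj C hI.conj_conj I hI.mem_unitary with hθ
  have hθF : θ F = F := hI.conj_eq hF hFodd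
  have hθU : θ U = star U := hUodd.star_mul_conjOp_mul
  have hθline : θ (linePath F U s) = F + s • (U * F * star U - F) := by
    rw [linePath_eq hU, map_add, map_smul, map_sub, map_mul, map_mul, map_star, hθF, hθU, star_star]
  have hUU := Unitary.star_mul_self_of_mem hU
  have hcancel : star U * (U * F * star U) * U = F := by
    calc star U * (U * F * star U) * U = (star U * U) * F * (star U * U) := by noncomm_ring
      _ = F := by rw [hUU, one_mul, mul_one]
  calc linePath F U (1 - s) = star U * F * U + s • (F - star U * F * U) := by
        rw [linePath_eq hU]; module
    _ = star U * (F + s • (U * F * star U - F)) * U := by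
        rw [mul_add, add_mul, mul_smul_comm, smul_mul_assoc, mul_sub, sub_mul, hcancel]
    _ = star U * (star I * conjOp C (linePath F U s) * I) * U := by rw [← hθline]; rfl
    _ = _ := by
        rw [transposeOp, ← conjOp_star hI.conj_conj, (isSelfAdjoint_linePath hF hU s).star_eq,
          star_mul]
        noncomm_ring

theorem linePath_mem_symmetricPaths (hI : IsQuaternionicData C I) (hp : (F, U) ∈ PairSpace C I) :
    linePath F U ∈ SymmetricPaths C I F U := by
  obtain ⟨hF, hFodd, hU, hUodd, hc⟩ := hp
  dsimp only at hF hFodd hU hUodd hc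
  have hsa : IsSelfAdjoint F := hF.1.1.2
  have hcomp : ∀ s : ℝ, IsCompactOperator ((s : ℂ) • (star U * (F * U - U * F)) : H →L[ℂ] H) :=
    fun s => (hc.clm_comp (star U)).smul (s : ℂ)
  refine ⟨(continuous_linePath F U).continuousOn, fun s hs => ?_, by simp [linePath],
    fun s _ => ?_, fun s _ => linePath_symm hI hsa hFodd hU hUodd s⟩
  · refine mem_SFhat_of_compact hF ?_ (hcomp s) (norm_linePath_le hF.2.1 hU hs)
    rw [star_mul_commutator hU, Complex.coe_smul]
    exact (IsSelfAdjoint.all s).smul ((isSelfAdjoint_star_mul_mul hsa).sub hsa)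
  · rw [linePath, add_sub_cancel_left]
    exact hcomp s

theorem Icc_half_subset : Icc (0 : ℝ) (1 / 2) ⊆ Icc 0 1 := Icc_subset_Icc_right (by norm_num)

theorem isKramers_half (hI : IsQuaternionicData C I) (hp : (F, U) ∈ PairSpace C I)
    {γ : ℝ → H →L[ℂ] H} (hγ : γ ∈ SymmetricPaths C I F U) : IsKramers C (I * U) (γ (1 / 2)) := by
  obtain ⟨-, hmem, -, -, hsymm⟩ := hγ
  have hhalf : (1 / 2 : ℝ) ∈ Icc (0 : ℝ) 1 := by constructor <;> norm_num
  have := hsymm _ hhalf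
  rw [show (1 - 1 / 2 : ℝ) = 1 / 2 by norm_num] at this
  exact hI.isKramers_mul hp.2.2.1 hp.2.2.2.1 (hmem _ hhalf).1.1.2 this

/-- The linear homotopy may leave `SFhat H`, but only self-adjointness, the Fredholm property and
Kramers symmetry at the ends matter. It is constantly `F` at `0` and commutes with `C I U` at `1/2`.
-/
theorem spectralFlow_cast_eq_of_mem_symmetricPaths (hI : IsQuaternionicData C I)
    (hp : (F, U) ∈ PairSpace C I) {γ₀ γ₁ : ℝ → H →L[ℂ] H} (h₀ : γ₀ ∈ SymmetricPaths C I F U)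
    (h₁ : γ₁ ∈ SymmetricPaths C I F U) :
    (spectralFlow γ₁ 0 (1 / 2) : ZMod 2) = spectralFlow γ₀ 0 (1 / 2) := by
  have k₀ := isKramers_half hI hp h₀
  have k₁ := isKramers_half hI hp h₁
  have kF : IsKramers C I F := hI.isKramers hp.1.1.1.2 hp.2.1
  obtain ⟨c₀, m₀, i₀, f₀, -⟩ := h₀
  obtain ⟨c₁, m₁, i₁, f₁, -⟩ := h₁
  have hhalf : (1 / 2 : ℝ) ∈ Icc (0 : ℝ) 1 := by constructor <;> norm_num
  have sa₀ : ∀ s ∈ Icc (0 : ℝ) 1, IsSelfAdjoint (γ₀ s) := fun s hs => (m₀ s hs).1.1.2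
  have sa₁ : ∀ s ∈ Icc (0 : ℝ) 1, IsSelfAdjoint (γ₁ s) := fun s hs => (m₁ s hs).1.1.2
  refine spectralFlow_cast_eq_of_homotopy (by norm_num) (c₀.mono Icc_half_subset)
    (c₁.mono Icc_half_subset) (fun s hs => sa₀ s (Icc_half_subset hs))
    (fun s hs => sa₁ s (Icc_half_subset hs)) (fun t s hs => ?_) (fun t a b => ?_) fun t a b => ?_
  · have hs' := Icc_half_subset hs
    have hcomp : IsCompactOperator (γ₁ s - γ₀ s) := by
      have := (f₁ s hs').sub (f₀ s hs')
      rw [← FunLike.coe_sub, sub_sub_sub_cancel_right] at this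
      exact this
    exact isFredholm_add_compact (sa₀ s hs') (m₀ s hs').1.1.1
      ((IsSelfAdjoint.all t).smul ((sa₁ s hs').sub (sa₀ s hs'))) (hcomp.smul t)
  · rw [i₀, i₁]
    simpa using kF.even_specRank hp.1.1.1.2 a b
  · exact (k₀.add_smul_sub k₁ t).even_specRank
      (isSelfAdjoint_add_smul_sub (sa₀ _ hhalf) (sa₁ _ hhalf) t) a b

theorem existsUnique_hasSpectralFlow_of_mem_symmetricPaths {γ : ℝ → H →L[ℂ] H}
    (hγ : γ ∈ SymmetricPaths C I F U) : ∃! k : ℤ, HasSpectralFlow γ 0 (1 / 2) k := by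
  obtain ⟨c, m, -⟩ := hγ
  have c' := c.mono Icc_half_subset
  have sa : ∀ s ∈ Icc (0 : ℝ) (1 / 2), IsSelfAdjoint (γ s) :=
    fun s hs => (m s (Icc_half_subset hs)).1.1.2
  obtain ⟨P⟩ := nonempty_flowPartition (by norm_num) c' sa
    fun s hs => (m s (Icc_half_subset hs)).1.1.1
  exact existsUnique_hasSpectralFlow P c' sa

theorem even_specRank_linePath (hI : IsQuaternionicData C I) (p : PairSpace C I) (a b : ℝ) :
    Even (specRank (linePath p.1.1 p.1.2 0) a b) ∧
      Even (specRank (linePath p.1.1 p.1.2 (1 / 2)) a b) := by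
  constructor
  · have h0 : linePath p.1.1 p.1.2 0 = p.1.1 := by simp [linePath]
    rw [h0]
    exact (hI.isKramers p.2.1.1.1.2 p.2.2.1).even_specRank p.2.1.1.1.2 a b
  · exact (isKramers_half hI p.2 (linePath_mem_symmetricPaths hI p.2)).even_specRank
      (isSelfAdjoint_linePath p.2.1.1.1.2 p.2.2.2.1 _) a b

/-- The segments of nearby pairs are uniformly close, and each has even ranks at both ends, though
the anti-unitary `C I U` at `1/2` changes with the pair. -/
theorem isLocallyConstant_SF2 (hI : IsQuaternionicData C I) : IsLocallyConstant (SF2 C I) := by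
  rw [IsLocallyConstant.iff_eventually_eq]
  intro p
  have hmem := linePath_mem_symmetricPaths hI p.2
  have hsa : ∀ q : PairSpace C I, ∀ s, IsSelfAdjoint (linePath q.1.1 q.1.2 s) :=
    fun q s => isSelfAdjoint_linePath q.2.1.1.1.2 q.2.2.2.1 s
  obtain ⟨ε, hε, hst⟩ := exists_spectralFlow_cast_eq (α := 0) (β := 1 / 2) (by norm_num)
    (continuous_linePath p.1.1 p.1.2).continuousOn (fun s _ => hsa p s)
    (fun s hs => (hmem.2.1 s (Icc_half_subset hs)).1.1.1)
    (fun a b => (even_specRank_linePath hI p a b).1) fun a b => (even_specRank_linePath hI p a b).2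
  let D : PairSpace C I → H →L[ℂ] H := fun q => star q.1.2 * (q.1.1 * q.1.2 - q.1.2 * q.1.1)
  have hD : Continuous D := by fun_prop
  have hF : Continuous fun q : PairSpace C I => q.1.1 := by fun_prop
  filter_upwards [hD.continuousAt (Metric.ball_mem_nhds (D p) (half_pos hε)),
    hF.continuousAt (Metric.ball_mem_nhds p.1.1 (half_pos hε))] with q h1 h2
  refine hst _ (continuous_linePath q.1.1 q.1.2).continuousOn (fun s _ => hsa q s) (fun s hs => ?_)
    (fun a b => (even_specRank_linePath hI q a b).1) fun a b => (even_specRank_linePath hI q a b).2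
  have h1' : ‖D q - D p‖ < ε / 2 := by simpa [dist_eq_norm] using h1
  have h2' : ‖q.1.1 - p.1.1‖ < ε / 2 := by simpa [dist_eq_norm] using h2
  have heq : linePath q.1.1 q.1.2 s - linePath p.1.1 p.1.2 s =
      (q.1.1 - p.1.1) + (s : ℂ) • (D q - D p) := by
    simp only [linePath, D, smul_sub]; abel
  have hs1 : ‖(s : ℂ)‖ ≤ 1 := by
    rw [Complex.norm_real, Real.norm_of_nonneg hs.1]
    exact (Icc_half_subset hs).2
  calc ‖linePath q.1.1 q.1.2 s - linePath p.1.1 p.1.2 s‖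
      ≤ ‖q.1.1 - p.1.1‖ + ‖(s : ℂ)‖ * ‖D q - D p‖ := by
        rw [heq, ← norm_smul]; exact norm_add_le _ _
    _ ≤ ‖q.1.1 - p.1.1‖ + ‖D q - D p‖ := by
        gcongr
        exact mul_le_of_le_one_left (norm_nonneg _) hs1
    _ < ε := by linarith

end Pair

end ZTwoFlow

end

theorem mainTheorem4 {H : Type*} [NormedAddCommGroup H] [InnerProductSpace ℂ H]
    [CompleteSpace H] [TopologicalSpace.SeparableSpace H]
    (C : H ≃ₗᵢ⋆[ℂ] H) (I : H →L[ℂ] H) (hI : ZTwoFlow.IsQuaternionicData C I) :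
    -- the function `SF₂` is well defined on the space of pairs
    (∀ p : ZTwoFlow.PairSpace C I,
      ZTwoFlow.linePath p.1.1 p.1.2 ∈ ZTwoFlow.SymmetricPaths C I p.1.1 p.1.2 ∧
      ∀ γ ∈ ZTwoFlow.SymmetricPaths C I p.1.1 p.1.2,
        (∃! k : ℤ, ZTwoFlow.HasSpectralFlow γ 0 (1 / 2) k) ∧
        (ZTwoFlow.spectralFlow γ 0 (1 / 2) : ZMod 2) = ZTwoFlow.SF2 C I p) ∧
    -- it is locally constant, and constant along continuous paths of pairs
    IsLocallyConstant (ZTwoFlow.SF2 C I) ∧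
    ∀ p q : ZTwoFlow.PairSpace C I, Joined p q → ZTwoFlow.SF2 C I p = ZTwoFlow.SF2 C I q := by
  refine ⟨fun p => ?_, ZTwoFlow.isLocallyConstant_SF2 hI, fun p q hpq => ?_⟩
  · have hline := ZTwoFlow.linePath_mem_symmetricPaths hI p.2
    exact ⟨hline, fun γ hγ =>
      ⟨ZTwoFlow.existsUnique_hasSpectralFlow_of_mem_symmetricPaths hγ,
        ZTwoFlow.spectralFlow_cast_eq_of_mem_symmetricPaths hI p.2 hline hγ⟩⟩
  · have := ((ZTwoFlow.isLocallyConstant_SF2 hI).comp_continuous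
      hpq.somePath.continuous).apply_eq_of_preconnectedSpace 0 1
    simpa using this
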